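/- Let $(X,\mathcal B,\mu)$ be an atomless standard Borel probability space and let $\mathrm{Aut}(X,\mu)$ be the group of measure preserving Borel isomorphisms of $X$, two of them being identified if they agree up to a nullset, with the weak topology, i.e. the coarsest topology for which $\varphi\mapsto\varphi(A)$ is continuous into the measure algebra (with the distance $\mu(A\triangle B)$) for every $A\in\mathcal B$. For a finite set $S$ let $A(S)=\mathrm{Aut}(X,\mu)^S$ with the product topology; its elements $f$ are the probability measure preserving actions $\gamma\mapsto f_\gamma$ of the free group $\mathbb F_S$ on $(X,\mu)$. Let $C(f)$ be the conjugacy class of $f$ under $\mathrm{Aut}(X,\mu)$. Say that $f$ weakly contains $h$ if $C(h)\subseteq\overline{C(f)}$, and that $f,g$ are weakly equivalent if each weakly contains the other. Say that $g$ contains $h$ (as a factor) if there is a measure preserving map $\Phi:X\to X$ such that $\Phi\circ g_\gamma=h_\gamma\circ\Phi$ almost everywhere for every $\gamma\in\mathbb F_S$. (1) If $f\in A(S)$ weakly contains $h\in A(S)$, then there is $g\in A(S)$ that is weakly equivalent to $f$ and contains $h$. Let $\Gamma$ be a countable group and $H$ a separable complex Hilbert space. For unitary representations $\alpha,\beta:\Gamma\to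 U(H)$ say that $\beta$ weakly contains $\alpha$ (in the sense of Zimmer) if for every finite orthonormal system $v_1,\dots,v_n$ in $H$, every finite $F\subset\Gamma$ and every $\varepsilon>0$ there is an orthonormal system $w_1,\dots,w_n$ in $H$ with $|\langle\alpha(\gamma)v_i,v_j\rangle-\langle\beta(\gamma)w_i,w_j\rangle|<\varepsilon$ for all $1\le i,j\le n$ and $\gamma\in F$. Weak equivalence means weak containment in both directions, and $\beta$ contains $\delta$ if there is a linear isometric embedding $T:H\to H$ with $T\delta(\gamma)=\beta(\gamma)T$ for all $\gamma\in\Gamma$. (2) If $\alpha:\Gamma\to U(H)$ weakly contains $\delta:\Gamma\to U(H)$, then there is $\beta:\Gamma\to U(H)$ that is weakly equivalent to $\alpha$ and contains $\delta$. -/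

import Mathlib

open MeasureTheory TopologicalSpace
open scoped symmDiff

noncomputable section

/-- The measure preserving Borel isomorphisms of `(X, μ)`, as a group under composition:
bijections that are measurable and measure preserving in both directions. -/
def MPIso {X : Type*} [MeasurableSpace X] (μ : Measure X) : Subgroup (Equiv.Perm X) where
  carrier := {φ | MeasurePreserving φ μ μ ∧ MeasurePreserving φ.symm μ μ}
  mul_mem' := fun ha hb => ⟨ha.1.comp hb.1, hb.2.comp ha.2⟩
  one_mem' := ⟨MeasurePreserving.id μ, MeasurePreserving.id μ⟩
  inv_mem' := fun ha => ⟨ha.2, ha.1⟩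

/-- The isomorphisms that agree with the identity up to a nullset. -/
def nullMPIso {X : Type*} [MeasurableSpace X] (μ : Measure X) : Subgroup (MPIso μ) where
  carrier := {φ | ∀ᵐ x ∂μ, φ.1 x = x}
  mul_mem' := by
    intro a b ha hb
    change ∀ᵐ x ∂μ, (a * b).1 x = x
    filter_upwards [ha, hb] with x hax hbx
    change a.1 (b.1 x) = x
    rw [hbx, hax]
  one_mem' := (Filter.Eventually.of_forall fun _ => rfl : ∀ᵐ x ∂μ, (1 : MPIso μ).1 x = x)
  inv_mem' := by
    intro a ha
    change ∀ᵐ x ∂μ, (a⁻¹).1 x = x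
    filter_upwards [ha] with x hax
    change a.1.symm x = x
    rw [Equiv.symm_apply_eq]
    exact hax.symm

instance nullMPIso_normal {X : Type*} [MeasurableSpace X] (μ : Measure X) :
    (nullMPIso μ).Normal where
  conj_mem := by
    intro n hn φ
    have h : ∀ᵐ x ∂μ, n.1 (φ.1.symm x) = φ.1.symm x :=
      φ.2.2.quasiMeasurePreserving.ae hn
    filter_upwards [h] with x hx
    change φ.1 (n.1 (φ.1.symm x)) = x
    rw [hx, Equiv.apply_symm_apply]

/-- `Aut(X, μ)`: measure preserving Borel isomorphisms, two of them being identified when they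
agree up to a nullset. -/
def MPAut {X : Type*} [MeasurableSpace X] (μ : Measure X) : Type _ := MPIso μ ⧸ nullMPIso μ

instance {X : Type*} [MeasurableSpace X] (μ : Measure X) : Group (MPAut μ) :=
  inferInstanceAs (Group (MPIso μ ⧸ nullMPIso μ))

/-- The class of a measure preserving Borel isomorphism. -/
def MPAut.mk {X : Type*} [MeasurableSpace X] {μ : Measure X} : MPIso μ →* MPAut μ :=
  QuotientGroup.mk' (nullMPIso μ)

theorem MPAut.mk_eq_mk_iff {X : Type*} [MeasurableSpace X] {μ : Measure X} (φ ψ : MPIso μ) :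
    MPAut.mk φ = MPAut.mk ψ ↔ ∀ᵐ x ∂μ, φ.1 x = ψ.1 x := by
  have h : MPAut.mk φ = MPAut.mk ψ ↔ ∀ᵐ x ∂μ, φ.1.symm (ψ.1 x) = x := QuotientGroup.eq
  rw [h]
  refine Filter.eventually_congr (Filter.Eventually.of_forall fun x => ?_)
  rw [Equiv.symm_apply_eq, eq_comm]

/-- The measure algebra of `(X, μ)`: measurable sets with the distance `μ (A ∆ B)`, sets at
distance zero being identified. -/
abbrev MeasAlg {X : Type*} [MeasurableSpace X] (μ : Measure X) : Type _ :=
  SeparationQuotient (MeasuredSets μ)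

/-- The image `φ(A)` of a measurable set under a measure preserving Borel isomorphism. -/
def MPIso.image {X : Type*} [MeasurableSpace X] {μ : Measure X} (φ : MPIso μ)
    (A : MeasuredSets μ) : MeasuredSets μ :=
  ⟨φ.1 '' A, by
    rw [Equiv.image_eq_preimage_symm]
    exact φ.2.2.measurable A.2⟩

/-- The image `φ(A)`, as an element of the measure algebra, of a measurable set under
`φ ∈ Aut(X, μ)`. -/
def MPAut.image {X : Type*} [MeasurableSpace X] {μ : Measure X} (φ : MPAut μ)
    (A : MeasuredSets μ) : MeasAlg μ :=
  Quotient.liftOn' φ (fun φ' => SeparationQuotient.mk (MPIso.image φ' A)) (by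
    intro φ ψ h
    have hae : ∀ᵐ x ∂μ, φ.1 x = ψ.1 x := (MPAut.mk_eq_mk_iff φ ψ).1 (Quotient.sound' h)
    have h2 : ∀ᵐ y ∂μ, φ.1.symm y = ψ.1.symm y := by
      filter_upwards [φ.2.2.quasiMeasurePreserving.ae hae] with y hy
      rw [Equiv.apply_symm_apply] at hy
      rw [Equiv.eq_symm_apply, ← hy]
    refine SeparationQuotient.mk_eq_mk.2 (EMetric.inseparable_iff.2 ?_)
    change μ ((φ.1 '' (A : Set X)) ∆ (ψ.1 '' (A : Set X))) = 0
    rw [measure_symmDiff_eq_zero_iff, Equiv.image_eq_preimage_symm, Equiv.image_eq_preimage_symm]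
    filter_upwards [h2] with y hy
    exact congrArg (fun z => ((A : Set X) z : Prop)) hy)

/-- The weak topology on `Aut(X, μ)`: the coarsest one for which `φ ↦ φ(A)` is continuous into
the measure algebra for every measurable `A`. It is the topology of each of the metrics
`∑ 2⁻ⁿ μ (φ(Aₙ) ∆ ψ(Aₙ))` with `(Aₙ)` generating the σ-algebra. -/
instance MPAut.weakTopology {X : Type*} [MeasurableSpace X] (μ : Measure X) :
    TopologicalSpace (MPAut μ) :=
  TopologicalSpace.induced (fun φ : MPAut μ => fun A : MeasuredSets μ => φ.image A) inferInstance

/-- `A(S) = Aut(X, μ)^S`, with the product topology. An element is the same as a p.m.p. action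
of the free group on `S`, see `PMPAction.act`. -/
abbrev PMPAction {X : Type*} [MeasurableSpace X] (S : Type*) (μ : Measure X) : Type _ :=
  S → MPAut μ

/-- The action of the free group on `S` given by `f ∈ A(S)`. -/
def PMPAction.act {X : Type*} [MeasurableSpace X] {S : Type*} {μ : Measure X}
    (f : PMPAction S μ) : FreeGroup S →* MPAut μ :=
  FreeGroup.lift f

/-- The conjugacy class `C(f)` of `f ∈ A(S)` under `Aut(X, μ)`. -/
def PMPAction.conjClass {X : Type*} [MeasurableSpace X] {S : Type*} {μ : Measure X}
    (f : PMPAction S μ) : Set (PMPAction S μ) :=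
  {k | ∃ φ : MPAut μ, ∀ s, k s = φ * f s * φ⁻¹}

/-- `f` weakly contains `g`: `C(g)` lies in the weak closure of `C(f)`. -/
def PMPAction.WeaklyContains {X : Type*} [MeasurableSpace X] {S : Type*} {μ : Measure X}
    (f g : PMPAction S μ) : Prop :=
  g.conjClass ⊆ closure f.conjClass

/-- `f` and `g` weakly contain each other. -/
def PMPAction.WeaklyEquivalent {X : Type*} [MeasurableSpace X] {S : Type*} {μ : Measure X}
    (f g : PMPAction S μ) : Prop :=
  f.WeaklyContains g ∧ g.WeaklyContains f

/-- `g` contains `h` as a factor: there is a measure preserving map `Φ : X → X` such that, for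
every `γ` in the free group, `Φ ∘ g_γ = h_γ ∘ Φ` almost everywhere. Here `a` and `b` are
representatives of `g_γ` and `h_γ`; their choice does not matter. -/
def PMPAction.HasFactor {X : Type*} [MeasurableSpace X] {S : Type*} {μ : Measure X}
    (g h : PMPAction S μ) : Prop :=
  ∃ Φ : X → X, MeasurePreserving Φ μ μ ∧
    ∀ (γ : FreeGroup S) (a b : MPIso μ), MPAut.mk a = g.act γ → MPAut.mk b = h.act γ →
      ∀ᵐ x ∂μ, Φ (a.1 x) = b.1 (Φ x)

/-- Unitary representations of the (discrete) group `Γ` on `H`. -/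
abbrev UnitaryRep (Γ H : Type*) [Group Γ] [NormedAddCommGroup H] [InnerProductSpace ℂ H]
    [CompleteSpace H] : Type _ :=
  Γ →* unitary (H →L[ℂ] H)

/-- `β` weakly contains `α` in the sense of Zimmer. (Mathlib's inner product is linear in the
second variable, so `inner ℂ y x` is `⟨x, y⟩`.) -/
def UnitaryRep.WeaklyContains {Γ H : Type*} [Group Γ] [NormedAddCommGroup H]
    [InnerProductSpace ℂ H] [CompleteSpace H] (β α : UnitaryRep Γ H) : Prop :=
  ∀ (n : ℕ) (v : Fin n → H), Orthonormal ℂ v → ∀ (F : Finset Γ) (ε : ℝ), 0 < ε →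
    ∃ w : Fin n → H, Orthonormal ℂ w ∧ ∀ i j, ∀ γ ∈ F,
      ‖inner ℂ (v j) ((α γ : H →L[ℂ] H) (v i)) - inner ℂ (w j) ((β γ : H →L[ℂ] H) (w i))‖ < ε

/-- `α` and `β` weakly contain each other in the sense of Zimmer. -/
def UnitaryRep.WeaklyEquivalent {Γ H : Type*} [Group Γ] [NormedAddCommGroup H]
    [InnerProductSpace ℂ H] [CompleteSpace H] (α β : UnitaryRep Γ H) : Prop :=
  UnitaryRep.WeaklyContains α β ∧ UnitaryRep.WeaklyContains β α

/-- `β` contains `δ` as a subrepresentation: there is an equivariant linear isometric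
embedding of `δ` into `β`. -/
def UnitaryRep.HasSubrep {Γ H : Type*} [Group Γ] [NormedAddCommGroup H]
    [InnerProductSpace ℂ H] [CompleteSpace H] (β δ : UnitaryRep Γ H) : Prop :=
  ∃ T : H →ₗᵢ[ℂ] H, ∀ (γ : Γ) (v : H), T ((δ γ : H →L[ℂ] H) v) = (β γ : H →L[ℂ] H) (T v)

end

/-!
Both parts are proved by putting the object to be contained next to the one that weakly contains
it, in a limit of the approximations that weak containment provides.

*Actions.* Let conjugates `φ f φ⁻¹` of `f` converge to `h` along an ultrafilter. The graphs of the
conjugating automorphisms `φ` are self-joinings of `μ`, and they have a limit joining `r`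
(`exists_coupling_tendsto`): the couplings of `μ` with itself are compact, and since their
marginals are fixed, weak convergence implies convergence on all measurable rectangles. On
rectangles `x ↦ (x, φ x)` nearly intertwines `f` with `f × h`
(`tendsto_symmDiff_graph`), so `r` is invariant under `f × h`. The action `g` is `f × h` on
`(X × X, r)`, moved to `(X, μ)` by an isomorphism of atomless standard probability spaces. Its
second coordinate is `h`. Both weak containments between `f` and `g` come from the criterion
`PMPAction.weaklyContains_of_tendsto`, which asks for maps that asymptotically preserve the measure
and asymptotically intertwine on a generating algebra: for `g` over `f` this is the first
coordinate, for `f` over `g` these are the graph maps. The criterion rests on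
`exists_measurePreserving_equiv_labels`: two finite partitions with nearly equal distributions are
nearly conjugate by an automorphism, as one sees by turning both into partitions of the unit
interval into consecutive intervals.

*Representations.* Let `α` weakly contain `δ`. In an ultrapower of `α` the approximations to a
Hilbert basis of `H` under `δ` become vectors with exactly the matrix coefficients of `δ`, which
span a copy of `δ` (`exists_equivariant_isometry_of_inner_eq`). The representation `β` is the
restriction of the ultrapower to the closed span of this copy and the diagonal copy of `α`. It
contains `α`, and it is weakly contained in `α` because the ultrapower is: bounded families are
evaluated at a suitable coordinate and orthonormalized
(`exists_orthonormal_near_of_ultraproduct`). Since orthonormal systems of the span can be moved to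
`H` and vice versa, the span has the Hilbert dimension of `H`, so that `β` can be realized on `H`;
this covers finite dimensional `H` as well.
-/

noncomputable section

open Set Filter Topology ENNReal

/-! ### Isomorphisms of atomless standard probability spaces -/

/-- Split the space as `ℝ × ℝ`: of the uncountably many disjoint fibres over the first factor,
all but countably many are null. -/
theorem exists_measurableSet_null_not_countable {X : Type*} [MeasurableSpace X]
    [StandardBorelSpace X] (μ : Measure X) [IsFiniteMeasure μ] (hX : ¬ Countable X) :
    ∃ C : Set X, MeasurableSet C ∧ ¬ C.Countable ∧ μ C = 0 := by
  have hR : ¬ Countable (ℝ × ℝ) := by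
    intro h
    exact not_countable (α := ℝ) (Function.Injective.countable (f := fun t : ℝ => (t, t))
      fun a b h => (Prod.ext_iff.1 h).1)
  let e : X ≃ᵐ ℝ × ℝ := PolishSpace.measurableEquivOfNotCountable hX hR
  let A : ℝ → Set X := fun t => (fun x => (e x).1) ⁻¹' {t}
  have hA : ∀ t, MeasurableSet (A t) := fun t =>
    (measurable_fst.comp e.measurable) (measurableSet_singleton t)
  have hd : Pairwise (Function.onFun Disjoint A) := by
    intro s t hst
    exact Disjoint.preimage _ (by simpa using hst)
  have hc := Measure.countable_meas_pos_of_disjoint_iUnion (μ := μ) hA hd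
  obtain ⟨t, ht⟩ : ∃ t, t ∉ {t | 0 < μ (A t)} := by
    by_contra! h
    exact not_countable (α := ℝ) (countable_univ_iff.1 (hc.mono fun t _ => h t))
  refine ⟨A t, hA t, fun h => ?_, by simpa using ht⟩
  have : range (fun s : ℝ => e.symm (t, s)) ⊆ A t := by
    rintro _ ⟨s, rfl⟩
    simp [A]
  have h2 := (h.mono this)
  refine not_countable (α := ℝ) (countable_univ_iff.1 ((countable_of_injective_of_countable_image
    (f := fun s : ℝ => e.symm (t, s)) (fun a _ b _ hab => ?_) (by rwa [image_univ]))))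
  exact (Prod.ext_iff.1 (e.symm.injective hab)).2

theorem not_countable_of_nullSingletonClass {X : Type*} [MeasurableSpace X] (μ : Measure X)
    [NullSingletonClass μ] [NeZero μ] : ¬ Countable X := fun _ =>
  NeZero.ne μ (Measure.measure_univ_eq_zero.1 (countable_univ.measure_zero μ))

/-- A measure preserving map that is injective off a nullset agrees almost everywhere with a Borel
isomorphism. On both sides an uncountable nullset is moved into the exceptional set, so that the
two exceptional sets are uncountable standard Borel spaces, hence isomorphic. -/
theorem MeasureTheory.MeasurePreserving.exists_measurableEquiv_ae_eq {X Y : Type*}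
    [MeasurableSpace X] [StandardBorelSpace X] [MeasurableSpace Y] [StandardBorelSpace Y]
    {μ : Measure X} {ν : Measure Y} [IsFiniteMeasure μ] [IsFiniteMeasure ν]
    (hX : ¬ Countable X) (hY : ¬ Countable Y) {F : X → Y} (hF : MeasurePreserving F μ ν)
    {E : Set X} (hE : MeasurableSet E) (hE0 : μ Eᶜ = 0) (hinj : InjOn F E) :
    ∃ e : X ≃ᵐ Y, e =ᵐ[μ] F := by
  classical
  obtain ⟨C, hC, hCc, hC0⟩ := exists_measurableSet_null_not_countable μ hX
  obtain ⟨D, hD, hDc, hD0⟩ := exists_measurableSet_null_not_countable ν hY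
  set E' : Set X := (E \ C) \ F ⁻¹' D with hE'
  have hE'm : MeasurableSet E' := (hE.diff hC).diff (hF.measurable hD)
  have hinj' : InjOn F E' := hinj.mono fun x hx => hx.1.1
  have := hE'm.standardBorel
  have hemb : MeasurableEmbedding (E'.domRestrict F) :=
    (hF.measurable.comp measurable_subtype_coe).measurableEmbedding (injOn_iff_injective.1 hinj')
  have hR : MeasurableSet (range (E'.domRestrict F)) := hemb.measurableSet_range
  have := hE'm.compl.standardBorel
  have := hR.compl.standardBorel
  have h1 : ¬ Countable (E'ᶜ : Set X) := by
    refine fun h => hCc ((countable_coe_iff.1 h).mono ?_)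
    exact fun x hx hx' => hx'.1.2 hx
  have h2 : ¬ Countable ((range (E'.domRestrict F))ᶜ : Set Y) := by
    refine fun h => hDc ((countable_coe_iff.1 h).mono ?_)
    rintro y hy ⟨x, rfl⟩
    exact x.2.2 hy
  refine ⟨(MeasurableEquiv.sumCompl hE'm).symm.trans
    ((MeasurableEquiv.sumCongr hemb.equivRange
      (PolishSpace.measurableEquivOfNotCountable h1 h2)).trans (MeasurableEquiv.sumCompl hR)), ?_⟩
  have h3 : ∀ᵐ x ∂μ, x ∈ E' := by
    have hD' : μ (F ⁻¹' D) = 0 := by rw [hF.measure_preimage hD.nullMeasurableSet, hD0]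
    filter_upwards [measure_eq_zero_iff_ae_notMem.1 hE0, measure_eq_zero_iff_ae_notMem.1 hC0,
      measure_eq_zero_iff_ae_notMem.1 hD'] with x hx1 hx2 hx3
    exact ⟨⟨by simpa using hx1, hx2⟩, hx3⟩
  filter_upwards [h3] with x hx
  have : (MeasurableEquiv.sumCompl hE'm).symm x = Sum.inl ⟨x, hx⟩ := by
    rw [MeasurableEquiv.symm_apply_eq]
    rfl
  simp only [MeasurableEquiv.trans_apply, this]
  change ((hemb.equivRange ⟨x, hx⟩ : range (E'.domRestrict F)) : Y) = F x
  rw [hemb.equivRange_apply]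
  rfl

theorem continuous_cdf (ν : Measure ℝ) [IsProbabilityMeasure ν] [NullSingletonClass ν] :
    Continuous (ProbabilityTheory.cdf ν) := by
  set G := ProbabilityTheory.cdf ν with hG
  refine continuous_iff_continuousAt.2 fun a => ?_
  rw [G.mono.continuousAt_iff_leftLim_eq_rightLim, G.rightLim_eq]
  refine le_antisymm (G.mono.leftLim_le le_rfl) ?_
  have h := G.measure_singleton a
  rw [hG, ProbabilityTheory.measure_cdf, measure_singleton, eq_comm, ENNReal.ofReal_eq_zero] at h
  linarith

/-- The distribution function of an atomless probability measure on the line pushes it to the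
uniform distribution. -/
theorem measurePreserving_cdf (ν : Measure ℝ) [IsProbabilityMeasure ν] [NullSingletonClass ν] :
    MeasurePreserving (ProbabilityTheory.cdf ν) ν (volume.restrict (Icc 0 1)) := by
  have hc := continuous_cdf ν
  set G := ProbabilityTheory.cdf ν with hG
  refine ⟨hc.measurable, ?_⟩
  have := Measure.isFiniteMeasure_map ν G
  refine Measure.ext_of_Iic _ _ fun t => ?_
  rw [Measure.map_apply hc.measurable measurableSet_Iic, Measure.restrict_apply measurableSet_Iic]
  have hv : Iic t ∩ Icc (0 : ℝ) 1 = Icc 0 (min t 1) := by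
    ext x; simp only [mem_inter_iff, mem_Iic, mem_Icc, le_min_iff]; tauto
  rw [hv, Real.volume_Icc, sub_zero]
  rcases lt_or_ge t 0 with h0 | h0
  · have : G ⁻¹' Iic t = ∅ := by
      ext x
      simpa using h0.trans_le (ProbabilityTheory.cdf_nonneg ν x)
    rw [this, measure_empty, eq_comm, ENNReal.ofReal_eq_zero]
    exact (min_le_left _ _).trans h0.le
  rcases le_or_gt 1 t with h1 | h1
  · have : G ⁻¹' Iic t = univ := by
      ext x
      simpa using (ProbabilityTheory.cdf_le_one ν x).trans h1
    rw [this, measure_univ, min_eq_right h1, ENNReal.ofReal_one]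
  rw [min_eq_left h1.le]
  rcases (G ⁻¹' Iic t).eq_empty_or_nonempty with he | hne
  · rw [he, measure_empty, eq_comm, ENNReal.ofReal_eq_zero]
    refine ge_of_tendsto' (ProbabilityTheory.tendsto_cdf_atBot ν) fun x => ?_
    exact le_of_not_ge fun hx => (he ▸ hx : x ∈ (∅ : Set ℝ)).elim
  · have hbdd : BddAbove (G ⁻¹' Iic t) := by
      obtain ⟨b, hb⟩ := ((ProbabilityTheory.tendsto_cdf_atTop ν).eventually_const_lt h1).exists
      refine ⟨b, fun x hx => le_of_not_gt fun hbx => ?_⟩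
      exact absurd (hb.trans_le (G.mono hbx.le)) (not_lt.2 hx)
    have hcl : IsClosed (G ⁻¹' Iic t) := isClosed_Iic.preimage hc
    set a := sSup (G ⁻¹' Iic t) with ha
    have haS : G a ≤ t := hcl.csSup_mem hne hbdd
    have hS : G ⁻¹' Iic t = Iic a := by
      ext x
      exact ⟨fun hx => le_csSup hbdd hx, fun hx => (G.mono hx).trans haS⟩
    have hat : G a = t := by
      refine le_antisymm haS (le_of_not_gt fun hlt => ?_)
      obtain ⟨x, hx1, hx2⟩ := (((hc.tendsto a).eventually_lt_const hlt).filter_mono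
        nhdsWithin_le_nhds |>.and (self_mem_nhdsWithin (s := Ioi a))).exists
      exact absurd (le_csSup hbdd (show x ∈ G ⁻¹' Iic t from hx1.le)) (not_le.2 hx2)
    rw [hS, ← hat, hG, ProbabilityTheory.ofReal_cdf]

/-- The distribution function of an atomless probability measure on the line is injective off a
nullset: every non-injectivity lies over one of the countably many values at rational points. -/
theorem exists_injOn_cdf (ν : Measure ℝ) [IsProbabilityMeasure ν] [NullSingletonClass ν] :
    ∃ E : Set ℝ, MeasurableSet E ∧ ν Eᶜ = 0 ∧ InjOn (ProbabilityTheory.cdf ν) E := by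
  set G := ProbabilityTheory.cdf ν
  have hG := measurePreserving_cdf ν
  refine ⟨(⋃ q : ℚ, G ⁻¹' {G q} ∩ Ioi (q : ℝ))ᶜ, ?_, ?_, ?_⟩
  · exact (MeasurableSet.iUnion fun q => (hG.measurable (measurableSet_singleton _)).inter
      measurableSet_Ioi).compl
  · rw [compl_compl, measure_iUnion_null_iff]
    intro q
    refine measure_mono_null inter_subset_left ?_
    rw [hG.measure_preimage (measurableSet_singleton _).nullMeasurableSet]
    simp
  · have key : ∀ x y : ℝ, x < y → G x = G y →
        y ∈ (⋃ q : ℚ, G ⁻¹' {G q} ∩ Ioi (q : ℝ)) := by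
      intro x y hxy h
      obtain ⟨q, hq1, hq2⟩ := exists_rat_btwn hxy
      refine mem_iUnion.2 ⟨q, ?_, hq2⟩
      exact le_antisymm (h ▸ G.mono hq1.le) (G.mono hq2.le)
    intro x hx y hy hxy
    rcases lt_trichotomy x y with h | h | h
    · exact absurd (key x y h hxy) hy
    · exact h
    · exact absurd (key y x h hxy.symm) hx

/-- An isomorphism with the unit interval under which a labelling `p : X → ℕ` becomes monotone: the
points with label `i` fill the interval between `μ {p < i}` and `μ {p < i + 1}`. It is the
distribution function of `x ↦ p x + u x`, where `u` is a Borel isomorphism onto `[0, 1)`. -/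
theorem exists_measurePreserving_equiv_real {X : Type*} [MeasurableSpace X] [StandardBorelSpace X]
    (μ : Measure X) [IsProbabilityMeasure μ] [NullSingletonClass μ]
    {p : X → ℕ} (hp : Measurable p) :
    ∃ e : X ≃ᵐ ℝ, MeasurePreserving e μ (volume.restrict (Icc 0 1)) ∧
      ∀ᵐ x ∂μ, e x ∈ Icc (μ.real {y | p y < p x}) (μ.real {y | p y < p x + 1}) := by
  have hX : ¬ Countable X := not_countable_of_nullSingletonClass μ
  have hI : ¬ Countable (Ico (0 : ℝ) 1) := by
    intro h
    have h2 := (countable_coe_iff.1 h).measure_zero (volume : Measure ℝ)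
    simp at h2
  have : StandardBorelSpace (Ico (0 : ℝ) 1) := measurableSet_Ico.standardBorel
  let u : X ≃ᵐ Ico (0 : ℝ) 1 := PolishSpace.measurableEquivOfNotCountable hX hI
  let j : X → ℝ := fun x => p x + (u x : ℝ)
  have hj : Measurable j :=
    (measurable_from_top.comp hp).add (measurable_subtype_coe.comp u.measurable)
  have hfl : ∀ x, ⌊j x⌋₊ = p x := fun x => by
    rw [Nat.floor_eq_iff (add_nonneg (Nat.cast_nonneg _) (u x).2.1)]
    exact ⟨le_add_of_nonneg_right (u x).2.1, by linarith [(u x).2.2]⟩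
  have hinj : Function.Injective j := fun x y hxy => by
    have h1 : p x = p y := by rw [← hfl x, ← hfl y, hxy]
    have h2 : (u x : ℝ) = u y := by simpa [j, h1] using hxy
    exact u.injective (Subtype.ext h2)
  set ν := μ.map j with hν
  have : IsProbabilityMeasure ν := Measure.isProbabilityMeasure_map hj.aemeasurable
  have : NullSingletonClass ν := ⟨fun t => by
    rw [hν, Measure.map_apply hj (measurableSet_singleton t)]
    exact (subsingleton_singleton.preimage hinj).measure_zero μ⟩
  obtain ⟨E, hE, hE0, hEinj⟩ := exists_injOn_cdf ν
  have hF : MeasurePreserving (ProbabilityTheory.cdf ν ∘ j) μ (volume.restrict (Icc 0 1)) :=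
    (measurePreserving_cdf ν).comp ⟨hj, rfl⟩
  obtain ⟨e, he⟩ := hF.exists_measurableEquiv_ae_eq hX not_countable (E := j ⁻¹' E) (hj hE)
    (by rw [← preimage_compl, ← Measure.map_apply hj hE.compl, hE0])
    (fun x hx y hy hxy => hinj (hEinj hx hy hxy))
  refine ⟨e, ⟨e.measurable, by rw [Measure.map_congr he, hF.map_eq]⟩, ?_⟩
  filter_upwards [he] with x hx
  rw [hx, Function.comp_apply, ProbabilityTheory.cdf_eq_real, hν,
    map_measureReal_apply hj measurableSet_Iic]
  refine ⟨measureReal_mono fun y (hy : p y < p x) => ?_, measureReal_mono fun y hy => ?_⟩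
  · have : (p y : ℝ) + 1 ≤ p x := by exact_mod_cast hy
    change (p y : ℝ) + u y ≤ p x + u x
    linarith [(u y).2.2, (u x).2.1]
  · have := Nat.floor_mono (show j y ≤ j x from hy)
    rw [hfl, hfl] at this
    exact Nat.lt_succ_of_le this

/-- Two labellings of atomless standard probability spaces with nearly the same distribution are
nearly matched by an isomorphism. When both are made monotone on the unit interval, the labels
disagree only between corresponding endpoints `μ {q < i}` and `ν {p < i}`. -/
theorem exists_measurePreserving_equiv_labels {X Y : Type*} [MeasurableSpace X]
    [StandardBorelSpace X] [MeasurableSpace Y] [StandardBorelSpace Y]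
    (μ : Measure X) [IsProbabilityMeasure μ] [NullSingletonClass μ]
    (ν : Measure Y) [IsProbabilityMeasure ν] [NullSingletonClass ν]
    {q : X → ℕ} (hq : Measurable q) {p : Y → ℕ} (hp : Measurable p) (n : ℕ) (hn : ∀ x, q x < n) :
    ∃ e : X ≃ᵐ Y, MeasurePreserving e μ ν ∧
      μ.real {x | p (e x) ≠ q x} ≤
        ∑ i ∈ Finset.range (n + 1), |ν.real {y | p y < i} - μ.real {x | q x < i}| := by
  obtain ⟨θ, hθ, hθq⟩ := exists_measurePreserving_equiv_real μ hq
  obtain ⟨η, hη, hηp⟩ := exists_measurePreserving_equiv_real ν hp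
  have he : MeasurePreserving (θ.trans η.symm) μ ν := (hη.symm η).comp hθ
  refine ⟨θ.trans η.symm, he, ?_⟩
  set a : ℕ → ℝ := fun i => ν.real {y | p y < i} with ha
  set b : ℕ → ℝ := fun i => μ.real {x | q x < i} with hb
  have hma : Monotone a := fun i j hij => measureReal_mono fun y (hy : p y < i) => hy.trans_le hij
  have hmb : Monotone b := fun i j hij => measureReal_mono fun y (hy : q y < i) => hy.trans_le hij
  have hsub : ({x | p (θ.trans η.symm x) ≠ q x} : Set X) ≤ᵐ[μ]
      ⋃ i ∈ Finset.range (n + 1), θ ⁻¹' uIcc (a i) (b i) := by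
    filter_upwards [hθq, he.quasiMeasurePreserving.ae hηp] with x hx1 hx2 hne
    have ht : η (θ.trans η.symm x) = θ x := by simp
    rw [ht] at hx2
    set y := θ.trans η.symm x
    refine mem_iUnion₂.2 ?_
    rcases lt_or_gt_of_ne hne with h | h
    · exact ⟨q x, by simpa using (hn x).le,
        mem_uIcc.2 (Or.inr ⟨hx1.1, hx2.2.trans (hma (Nat.succ_le_of_lt h))⟩)⟩
    · refine ⟨q x + 1, by simpa using hn x,
        mem_uIcc.2 (Or.inl ⟨(hma (Nat.succ_le_of_lt h)).trans hx2.1, hx1.2⟩)⟩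
  calc μ.real {x | p (θ.trans η.symm x) ≠ q x}
      ≤ μ.real (⋃ i ∈ Finset.range (n + 1), θ ⁻¹' uIcc (a i) (b i)) := by
        exact ENNReal.toReal_mono (measure_ne_top _ _) (measure_mono_ae hsub)
    _ ≤ ∑ i ∈ Finset.range (n + 1), μ.real (θ ⁻¹' uIcc (a i) (b i)) :=
        measureReal_biUnion_finset_le _ _
    _ ≤ _ := by
        refine Finset.sum_le_sum fun i _ => ?_
        rw [hθ.measureReal_preimage measurableSet_uIcc.nullMeasurableSet, abs_sub_comm]
        refine (ENNReal.toReal_mono ?_ (Measure.restrict_apply_le _ _)).trans ?_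
        · rw [uIcc, Real.volume_Icc]; exact ENNReal.ofReal_ne_top
        · rw [uIcc, Real.volume_Icc, max_sub_min_eq_abs, ENNReal.toReal_ofReal (abs_nonneg _)]

/-- Any two atomless standard Borel probability spaces are isomorphic. -/
theorem exists_measurePreserving_equiv {X Y : Type*} [MeasurableSpace X]
    [StandardBorelSpace X] [MeasurableSpace Y] [StandardBorelSpace Y]
    (μ : Measure X) [IsProbabilityMeasure μ] [NullSingletonClass μ]
    (ν : Measure Y) [IsProbabilityMeasure ν] [NullSingletonClass ν] :
    ∃ e : X ≃ᵐ Y, MeasurePreserving e μ ν := by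
  obtain ⟨e, he, -⟩ := exists_measurePreserving_equiv_labels μ ν (q := fun _ => 0)
    measurable_const (p := fun _ => 0) measurable_const 1 (fun _ => one_pos)
  exact ⟨e, he⟩

/-! ### A criterion for weak containment of actions -/

section

variable {X : Type*} [MeasurableSpace X] {μ : Measure X}

theorem MPIso.measurableSet_image (φ : MPIso μ) {A : Set X} (hA : MeasurableSet A) :
    MeasurableSet (φ.1 '' A) := by
  rw [Equiv.image_eq_preimage_symm]
  exact φ.2.2.measurable hA

theorem MPIso.measure_image (φ : MPIso μ) {A : Set X} (hA : MeasurableSet A) :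
    μ (φ.1 '' A) = μ A := by
  rw [Equiv.image_eq_preimage_symm]
  exact φ.2.2.measure_preimage hA.nullMeasurableSet

theorem MPIso.measure_image_symmDiff (φ : MPIso μ) {A B : Set X} (hA : MeasurableSet A)
    (hB : MeasurableSet B) : μ ((φ.1 '' A) ∆ (φ.1 '' B)) = μ (A ∆ B) := by
  rw [← image_symmDiff φ.1.injective, MPIso.measure_image φ (hA.symmDiff hB)]

theorem MPAut.tendsto_mk_iff {ι : Type*} {l : Filter ι} {κ : ι → MPIso μ} {γ : MPIso μ} :
    Tendsto (fun i => MPAut.mk (κ i)) l (𝓝 (MPAut.mk γ)) ↔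
      ∀ A, MeasurableSet A → Tendsto (fun i => μ (((κ i).1 '' A) ∆ (γ.1 '' A))) l (𝓝 0) := by
  rw [nhds_induced, tendsto_comap_iff, tendsto_pi_nhds]
  constructor
  · intro h A hA
    exact tendsto_iff_edist_tendsto_0.1 (h ⟨A, hA⟩)
  · intro h A
    exact tendsto_iff_edist_tendsto_0.2 (h A.1 A.2)

theorem MPAut.mk_surjective : Function.Surjective (MPAut.mk : MPIso μ → MPAut μ) :=
  QuotientGroup.mk'_surjective _

theorem MPAut.continuous_conj (φ : MPAut μ) : Continuous fun k : MPAut μ => φ * k * φ⁻¹ := by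
  refine continuous_iff_continuousAt.2 fun a => ?_
  obtain ⟨φ, rfl⟩ := MPAut.mk_surjective φ
  obtain ⟨a, rfl⟩ := MPAut.mk_surjective a
  choose κ hκ using MPAut.mk_surjective (μ := μ)
  have h : Tendsto (fun k : MPAut μ => MPAut.mk (κ k)) (𝓝 (MPAut.mk a)) (𝓝 (MPAut.mk a)) := by
    simp only [hκ]
    exact tendsto_id
  have h2 : Tendsto (fun k : MPAut μ => MPAut.mk (φ * κ k * φ⁻¹)) (𝓝 (MPAut.mk a))
      (𝓝 (MPAut.mk (φ * a * φ⁻¹))) := by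
    rw [MPAut.tendsto_mk_iff] at h ⊢
    intro A hA
    have hA' : MeasurableSet (φ⁻¹.1 '' A) := MPIso.measurableSet_image _ hA
    refine (h _ hA').congr fun k => ?_
    have hc : ∀ b : MPIso μ, (φ * b * φ⁻¹).1 '' A = φ.1 '' (b.1 '' (φ⁻¹.1 '' A)) := fun b => by
      simp only [image_image]; rfl
    rw [hc, hc, MPIso.measure_image_symmDiff _ (MPIso.measurableSet_image _ hA')
      (MPIso.measurableSet_image _ hA')]
  simp only [map_mul, map_inv, hκ] at h2
  exact h2

/-- Conjugation by an automorphism is continuous and preserves `C(f)`, so it is enough that one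
point of `C(g)` lies in the closure of `C(f)`. -/
theorem PMPAction.WeaklyContains.of_mem_closure {S : Type*} {f g : PMPAction S μ}
    (h : g ∈ closure f.conjClass) : f.WeaklyContains g := by
  rintro k ⟨φ, hk⟩
  obtain rfl : k = fun s => φ * g s * φ⁻¹ := funext hk
  have hc : Continuous fun (k : PMPAction S μ) s => φ * k s * φ⁻¹ :=
    continuous_pi fun s => (MPAut.continuous_conj φ).comp (continuous_apply s)
  refine map_mem_closure hc h ?_
  rintro m ⟨ψ, hm⟩
  exact ⟨φ * ψ, fun s => by simp only [hm]; group⟩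

end

/-- Finitely many sets of an algebra are encoded by a labelling with finitely many values, whose
lower level sets lie in the algebra. -/
theorem MeasureTheory.IsSetAlgebra.exists_label {X : Type*} {𝒜 : Set (Set X)}
    (h𝒜 : IsSetAlgebra 𝒜) {T : Set (Set X)} (hT : T.Finite) (hT𝒜 : T ⊆ 𝒜) :
    ∃ (n : ℕ) (p : X → ℕ), (∀ x, p x < n) ∧ (∀ i, {x | p x < i} ∈ 𝒜) ∧
      ∀ C ∈ T, ∀ x y, p x = p y → (x ∈ C ↔ y ∈ C) := by
  classical
  induction T, hT using Set.Finite.induction_on with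
  | empty =>
    refine ⟨1, fun _ => 0, fun _ => one_pos, fun i => ?_, by simp⟩
    rcases i.eq_zero_or_pos with rfl | hi
    · simpa using h𝒜.empty_mem
    · simpa [hi] using h𝒜.univ_mem
  | @insert C T _ _ ih =>
    obtain ⟨n, p, hn, hp, hpT⟩ := ih ((subset_insert _ _).trans hT𝒜)
    have hC : C ∈ 𝒜 := hT𝒜 (mem_insert _ _)
    refine ⟨2 * n, fun x => 2 * p x + if x ∈ C then 1 else 0, fun x => ?_, fun i => ?_, ?_⟩
    · have := hn x
      dsimp only
      split_ifs <;> omega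
    · have : {x | 2 * p x + (if x ∈ C then 1 else 0) < i} =
          (C ∩ {x | p x < i / 2}) ∪ (Cᶜ ∩ {x | p x < (i + 1) / 2}) := by
        ext x
        by_cases hx : x ∈ C
        · simp [hx]; omega
        · simp [hx]; omega
      rw [this]
      exact h𝒜.union_mem (h𝒜.inter_mem hC (hp _)) (h𝒜.inter_mem (h𝒜.compl_mem hC) (hp _))
    · intro D hD x y hxy
      have h1 : p x = p y := by
        dsimp only at hxy
        split_ifs at hxy <;> omega
      rcases mem_insert_iff.1 hD with rfl | hD
      · by_cases hx : x ∈ D <;> by_cases hy : y ∈ D <;> simp [hx, hy, h1] at hxy ⊢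
      · exact hpT D hD x y h1

section

variable {X : Type*} [MeasurableSpace X] [StandardBorelSpace X] {μ : Measure X}
  [IsProbabilityMeasure μ] [NullSingletonClass μ]

/-- If the maps `ρ i` asymptotically preserve the measure of the sets of a `g`-invariant algebra and
asymptotically intertwine `f` with `g` on them, then some conjugate of `f` is close to `g` on any
finite part of the algebra. The maps `ρ i` need not be injective; the conjugating automorphism
only has to move the partition generated by the given sets as `ρ i` does. -/
theorem exists_conj_near {S : Type*} [Finite S] (f g : S → MPIso μ) {𝒜 : Set (Set X)}
    (h𝒜 : IsSetAlgebra 𝒜) (hm : ∀ C ∈ 𝒜, MeasurableSet C)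
    (hinv : ∀ s, ∀ C ∈ 𝒜, (g s).1 '' C ∈ 𝒜) {ι : Type*} {l : Filter ι} [NeBot l]
    {ρ : ι → X → X} (hρ : ∀ i, Measurable (ρ i))
    (h1 : ∀ C ∈ 𝒜, Tendsto (fun i => μ.real (ρ i ⁻¹' C)) l (𝓝 (μ.real C)))
    (h2 : ∀ s, ∀ C ∈ 𝒜,
      Tendsto (fun i => μ.real (((f s).1 '' (ρ i ⁻¹' C)) ∆ (ρ i ⁻¹' ((g s).1 '' C)))) l (𝓝 0))
    {T : Set (Set X)} (hT : T.Finite) (hT𝒜 : T ⊆ 𝒜) {ε : ℝ} (hε : 0 < ε) :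
    ∃ ψ : MPIso μ, ∀ s, ∀ C ∈ T, μ.real (((ψ * f s * ψ⁻¹).1 '' C) ∆ ((g s).1 '' C)) ≤ 3 * ε := by
  have hT' : (T ∪ ⋃ s, (fun C => (g s).1 '' C) '' T).Finite :=
    hT.union (finite_iUnion fun s => hT.image _)
  obtain ⟨n, p, hn, hp, hpT⟩ := h𝒜.exists_label hT' (by
    refine union_subset hT𝒜 (iUnion_subset fun s => ?_)
    rintro _ ⟨C, hC, rfl⟩
    exact hinv s C (hT𝒜 hC))
  have hpm : Measurable p := measurable_of_Iio fun i => hm _ (hp i)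
  have e1 : ∀ᶠ i in l, ∑ k ∈ Finset.range (n + 1),
      |μ.real {y | p y < k} - μ.real {x | p (ρ i x) < k}| < ε := by
    have : Tendsto (fun i => ∑ k ∈ Finset.range (n + 1),
        |μ.real {y | p y < k} - μ.real {x | p (ρ i x) < k}|) l
        (𝓝 (∑ k ∈ Finset.range (n + 1), |μ.real {y | p y < k} - μ.real {y | p y < k}|)) :=
      tendsto_finsetSum _ fun k _ => (tendsto_const_nhds.sub (h1 _ (hp k))).abs
    simp only [sub_self, abs_zero, Finset.sum_const_zero] at this
    exact this.eventually_lt_const hε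
  have e2 : ∀ᶠ i in l, ∀ s, ∀ C ∈ T,
      μ.real (((f s).1 '' (ρ i ⁻¹' C)) ∆ (ρ i ⁻¹' ((g s).1 '' C))) < ε := by
    rw [eventually_all]
    intro s
    rw [hT.eventually_all]
    intro C hC
    exact (h2 s C (hT𝒜 hC)).eventually_lt_const hε
  obtain ⟨i, hi1, hi2⟩ := (e1.and e2).exists
  obtain ⟨e, he, heN⟩ := exists_measurePreserving_equiv_labels μ μ (hpm.comp (hρ i)) hpm n
    (fun x => hn _)
  replace heN := (heN.trans_lt hi1).le
  let ψ : MPIso μ := ⟨e.toEquiv, he, he.symm e⟩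
  have hψ : ∀ C, C ∈ T ∪ ⋃ s, (fun C => (g s).1 '' C) '' T →
      μ.real ((e ⁻¹' C) ∆ (ρ i ⁻¹' C)) ≤ ε := by
    intro C hC
    refine (measureReal_mono fun x hx => ?_).trans heN
    intro hpx
    have := hpT C hC _ _ hpx
    rcases hx with hx | hx
    · exact hx.2 (this.1 hx.1)
    · exact hx.2 (this.2 hx.1)
  refine ⟨ψ, fun s C hC => ?_⟩
  have hCm := hm _ (hT𝒜 hC)
  have hgC := MPIso.measurableSet_image (g s) hCm
  have hc : (ψ * f s * ψ⁻¹).1 '' C = ψ.1 '' ((f s).1 '' (e ⁻¹' C)) := by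
    rw [show e ⁻¹' C = ψ⁻¹.1 '' C from (e.toEquiv.image_symm_eq_preimage C).symm]
    simp only [image_image]; rfl
  have hg : (g s).1 '' C = ψ.1 '' (e ⁻¹' ((g s).1 '' C)) :=
    (e.toEquiv.image_preimage _).symm
  have hm1 := MPIso.measurableSet_image (f s) (e.measurable hCm)
  have k1 : μ.real (((f s).1 '' (e ⁻¹' C)) ∆ ((f s).1 '' (ρ i ⁻¹' C))) ≤ ε := by
    rw [Measure.real, MPIso.measure_image_symmDiff (f s) (e.measurable hCm) (hρ i hCm)]
    exact hψ C (Or.inl hC)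
  have k2 : μ.real ((ρ i ⁻¹' ((g s).1 '' C)) ∆ (e ⁻¹' ((g s).1 '' C))) ≤ ε := by
    rw [symmDiff_comm]
    exact hψ _ (Or.inr (mem_iUnion.2 ⟨s, mem_image_of_mem _ hC⟩))
  have k3 := (hi2 s C hC).le
  rw [hc, hg, Measure.real, MPIso.measure_image_symmDiff ψ hm1 (e.measurable hgC)]
  change μ.real _ ≤ _
  have t1 := measureReal_symmDiff_le (μ := μ) (s := (f s).1 '' (e ⁻¹' C))
    (t := (f s).1 '' (ρ i ⁻¹' C)) (e ⁻¹' ((g s).1 '' C))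
  have t2 := measureReal_symmDiff_le (μ := μ) (s := (f s).1 '' (ρ i ⁻¹' C))
    (t := ρ i ⁻¹' ((g s).1 '' C)) (e ⁻¹' ((g s).1 '' C))
  linarith

/-- A criterion for `f` to weakly contain `g`: the closeness given by `exists_conj_near` on a
generating algebra extends to all measurable sets, since the algebra is dense in the measure
algebra and automorphisms act on it by isometries. -/
theorem PMPAction.weaklyContains_of_tendsto {S : Type*} [Finite S] (f g : S → MPIso μ)
    {𝒜 : Set (Set X)} (h𝒜 : IsSetAlgebra 𝒜) (hgen : ‹MeasurableSpace X› = .generateFrom 𝒜)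
    (hinv : ∀ s, ∀ C ∈ 𝒜, (g s).1 '' C ∈ 𝒜) {ι : Type*} {l : Filter ι} [NeBot l]
    {ρ : ι → X → X} (hρ : ∀ i, Measurable (ρ i))
    (h1 : ∀ C ∈ 𝒜, Tendsto (fun i => μ.real (ρ i ⁻¹' C)) l (𝓝 (μ.real C)))
    (h2 : ∀ s, ∀ C ∈ 𝒜,
      Tendsto (fun i => μ.real (((f s).1 '' (ρ i ⁻¹' C)) ∆ (ρ i ⁻¹' ((g s).1 '' C)))) l (𝓝 0)) :
    PMPAction.WeaklyContains (fun s => MPAut.mk (f s)) (fun s => MPAut.mk (g s)) := by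
  classical
  refine .of_mem_closure ?_
  have hm : ∀ C ∈ 𝒜, MeasurableSet C := fun C hC => by
    rw [hgen]; exact MeasurableSpace.measurableSet_generateFrom hC
  have key : ∀ i : Finset 𝒜 × ℕ, ∃ ψ : MPIso μ, ∀ s, ∀ C ∈ i.1,
      μ.real (((ψ * f s * ψ⁻¹).1 '' (C : Set X)) ∆ ((g s).1 '' C)) ≤ 1 / ((i.2 : ℝ) + 1) := by
    intro i
    obtain ⟨ψ, hψ⟩ := exists_conj_near f g h𝒜 hm hinv hρ h1 h2
      (T := Subtype.val '' (i.1 : Set 𝒜)) (i.1.finite_toSet.image _)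
      (by rintro _ ⟨C, -, rfl⟩; exact C.2) (ε := 1 / ((i.2 : ℝ) + 1) / 3) (by positivity)
    refine ⟨ψ, fun s C hC => ?_⟩
    have := hψ s C ⟨C, hC, rfl⟩
    linarith
  choose ψ hψ using key
  refine mem_closure_of_tendsto (b := atTop)
    (f := fun i : Finset 𝒜 × ℕ => fun s => MPAut.mk (ψ i * f s * (ψ i)⁻¹)) ?_
    (Eventually.of_forall fun i => ⟨MPAut.mk (ψ i), fun s => by simp⟩)
  refine tendsto_pi_nhds.2 fun s => MPAut.tendsto_mk_iff.2 fun A hA => ?_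
  rw [ENNReal.tendsto_nhds_zero]
  intro ε hε
  wlog hε' : ε ≠ ⊤
  · filter_upwards with i
    simp only [not_not] at hε'
    simp [hε']
  obtain ⟨δ, hδ, hδε⟩ : ∃ δ : ℝ, 0 < δ ∧ ENNReal.ofReal δ = ε / 3 :=
    ⟨(ε / 3).toReal, ENNReal.toReal_pos (by simp [hε.ne']) (by finiteness),
      ENNReal.ofReal_toReal (by finiteness)⟩
  obtain ⟨C, hC, hCA⟩ := exists_measure_symmDiff_lt_of_generateFrom_isSetRing (μ := μ)
    h𝒜.isSetRing ⟨{univ}, countable_singleton _, by simpa using h𝒜.univ_mem, by simp⟩ hgen hA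
    (ENNReal.div_pos hε.ne' (by simp : (3 : ℝ≥0∞) ≠ ⊤))
  obtain ⟨N, hN⟩ := exists_nat_one_div_lt hδ
  filter_upwards [eventually_ge_atTop (({⟨C, hC⟩}, N) : Finset 𝒜 × ℕ)] with i hi
  have hb := hψ i s ⟨C, hC⟩ (hi.1 (by simp))
  have hb' : μ (((ψ i * f s * (ψ i)⁻¹).1 '' C) ∆ ((g s).1 '' C)) ≤ ε / 3 := by
    rw [← hδε, ← ENNReal.ofReal_toReal (measure_ne_top μ _)]
    refine ENNReal.ofReal_le_ofReal (hb.trans (le_trans ?_ hN.le))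
    exact one_div_le_one_div_of_le (by positivity) (by simpa using hi.2)
  set κ := ψ i * f s * (ψ i)⁻¹
  have t1 := measure_symmDiff_le (μ := μ) (κ.1 '' A) (κ.1 '' C) ((g s).1 '' A)
  have t2 := measure_symmDiff_le (μ := μ) (κ.1 '' C) ((g s).1 '' C) ((g s).1 '' A)
  rw [MPIso.measure_image_symmDiff κ hA (hm C hC)] at t1
  rw [MPIso.measure_image_symmDiff (g s) (hm C hC) hA] at t2
  calc _ ≤ _ := t1
    _ ≤ ε / 3 + (ε / 3 + ε / 3) := by
      refine add_le_add (by rw [symmDiff_comm]; exact hCA.le) (t2.trans (add_le_add hb' hCA.le))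
    _ = ε := by rw [← add_assoc, ENNReal.add_thirds]

end

/-! ### Limits of couplings -/

theorem exists_compact_metrizable_borelSpace (X : Type*) [MeasurableSpace X] [StandardBorelSpace X]
    (hX : ¬ Countable X) :
    ∃ _ : TopologicalSpace X, CompactSpace X ∧ MetrizableSpace X ∧ BorelSpace X := by
  have hI : ¬ Countable unitInterval := by
    intro h
    have h2 := (countable_coe_iff.1 h).measure_zero (volume : Measure ℝ)
    simp [unitInterval] at h2
  let e : X ≃ᵐ unitInterval := PolishSpace.measurableEquivOfNotCountable hX hI
  let τ : TopologicalSpace X := .induced e inferInstance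
  let h : X ≃ₜ unitInterval := e.toEquiv.toHomeomorphOfIsInducing ⟨rfl⟩
  refine ⟨τ, h.symm.compactSpace, h.isEmbedding.metrizableSpace, ⟨?_⟩⟩
  rw [← e.measurableEmbedding.comap_eq, borel_comap]
  exact congrArg _ (BorelSpace.measurable_eq (α := unitInterval))

/-- A coupling (joining) of `μ` and `ν`: a measure on the product with these marginals. -/
def IsCoupling {X Y : Type*} [MeasurableSpace X] [MeasurableSpace Y] (μ : Measure X)
    (ν : Measure Y) (ρ : Measure (X × Y)) : Prop :=
  MeasurePreserving Prod.fst ρ μ ∧ MeasurePreserving Prod.snd ρ ν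

/-- The algebra of sets generated by the measurable cylinders `A × Y` and `X × B`; it consists of
the finite unions of measurable rectangles. -/
def cylinderAlgebra (X Y : Type*) [MeasurableSpace X] [MeasurableSpace Y] : Set (Set (X × Y)) :=
  generateSetAlgebra ({C | ∃ A, MeasurableSet A ∧ C = Prod.fst ⁻¹' A} ∪
    {C | ∃ B, MeasurableSet B ∧ C = Prod.snd ⁻¹' B})

theorem isSetAlgebra_cylinderAlgebra (X Y : Type*) [MeasurableSpace X] [MeasurableSpace Y] :
    IsSetAlgebra (cylinderAlgebra X Y) := isSetAlgebra_generateSetAlgebra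

theorem generateFrom_cylinderAlgebra (X Y : Type*) [MeasurableSpace X] [MeasurableSpace Y] :
    (Prod.instMeasurableSpace : MeasurableSpace (X × Y)) = .generateFrom (cylinderAlgebra X Y) := by
  rw [cylinderAlgebra, generateFrom_generateSetAlgebra_eq]
  refine le_antisymm (sup_le ?_ ?_) (MeasurableSpace.generateFrom_le ?_)
  · rintro _ ⟨A, hA, rfl⟩
    exact MeasurableSpace.measurableSet_generateFrom (Or.inl ⟨A, hA, rfl⟩)
  · rintro _ ⟨A, hA, rfl⟩
    exact MeasurableSpace.measurableSet_generateFrom (Or.inr ⟨A, hA, rfl⟩)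
  · rintro _ (⟨A, hA, rfl⟩ | ⟨A, hA, rfl⟩)
    exacts [measurable_fst hA, measurable_snd hA]

theorem MeasurableSet.of_mem_cylinderAlgebra {X Y : Type*} [MeasurableSpace X] [MeasurableSpace Y]
    {C : Set (X × Y)} (hC : C ∈ cylinderAlgebra X Y) : MeasurableSet C := by
  rw [generateFrom_cylinderAlgebra]
  exact MeasurableSpace.measurableSet_generateFrom hC

theorem exists_continuous_integral_indicator_sub_le {X : Type*} [TopologicalSpace X]
    [CompactSpace X] [MetrizableSpace X] [MeasurableSpace X] [BorelSpace X] (μ : Measure X)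
    [IsFiniteMeasure μ] {A : Set X} (hA : MeasurableSet A) {ε : ℝ} (hε : 0 < ε) :
    ∃ u : C(X, ℝ), (∀ x, u x ∈ Icc 0 1) ∧ ∫ x, |A.indicator 1 x - u x| ∂μ ≤ ε := by
  let _ := metrizableSpaceMetric X
  obtain ⟨F, hFA, hF, hFε⟩ := hA.exists_isClosed_sdiff_lt (measure_ne_top μ A)
    (ENNReal.ofReal_pos.2 (half_pos hε)).ne'
  obtain ⟨U, hAU, hU, -, hUε⟩ := hA.exists_isOpen_sdiff_lt (measure_ne_top μ A)
    (ENNReal.ofReal_pos.2 (half_pos hε)).ne'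
  obtain ⟨u, hu0, hu1, hu⟩ := exists_continuous_zero_one_of_isClosed hU.isClosed_compl hF
    (disjoint_compl_left_iff_subset.2 (hFA.trans hAU))
  refine ⟨u, hu, ?_⟩
  have hm : MeasurableSet (U \ F) := hU.measurableSet.diff hF.measurableSet
  have hle : ∀ x, |A.indicator 1 x - u x| ≤ (U \ F).indicator (1 : X → ℝ) x := by
    intro x
    by_cases hxU : x ∈ U
    · by_cases hxF : x ∈ F
      · simp [hFA hxF, hu1 hxF, hxF]
      · have := hu x
        by_cases hxA : x ∈ A <;> simp [hxU, hxF, hxA] <;> rw [abs_le] <;>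
          constructor <;> linarith [this.1, this.2]
    · have hxA : x ∉ A := fun h => hxU (hAU h)
      simp [hxU, hxA, hu0 (show x ∈ Uᶜ from hxU)]
  calc ∫ x, |A.indicator 1 x - u x| ∂μ ≤ ∫ x, (U \ F).indicator (1 : X → ℝ) x ∂μ := by
        refine integral_mono_of_nonneg (.of_forall fun x => abs_nonneg _) ?_ (.of_forall hle)
        exact (integrable_const (1 : ℝ)).indicator hm
    _ = μ.real (U \ F) := integral_indicator_one hm
    _ ≤ μ.real ((U \ A) ∪ (A \ F)) := measureReal_mono (by
        intro x hx; by_cases h : x ∈ A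
        · exact Or.inr ⟨h, hx.2⟩
        · exact Or.inl ⟨hx.1, h⟩)
    _ ≤ μ.real (U \ A) + μ.real (A \ F) := measureReal_union_le _ _
    _ ≤ ε / 2 + ε / 2 := add_le_add (ENNReal.toReal_le_of_le_ofReal (half_pos hε).le hUε.le)
        (ENNReal.toReal_le_of_le_ofReal (half_pos hε).le hFε.le)
    _ = ε := add_halves ε

section

variable {X Y : Type*} [MeasurableSpace X] [MeasurableSpace Y] {μ : Measure X} {ν : Measure Y}

theorem IsCoupling.isProbabilityMeasure [IsProbabilityMeasure μ] {ρ : Measure (X × Y)}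
    (hρ : IsCoupling μ ν ρ) : IsProbabilityMeasure ρ :=
  ⟨by rw [← preimage_univ (f := Prod.fst), hρ.1.measure_preimage nullMeasurableSet_univ,
    measure_univ]⟩

/-- A set of the cylinder algebra is approximated by a continuous function in `L¹` of all couplings
of `μ` and `ν` at once: for a cylinder the error only depends on a marginal. -/
theorem IsCoupling.exists_continuous_approx [TopologicalSpace X] [CompactSpace X]
    [MetrizableSpace X] [BorelSpace X] [TopologicalSpace Y] [CompactSpace Y]
    [MetrizableSpace Y] [BorelSpace Y] [IsProbabilityMeasure μ] [IsProbabilityMeasure ν]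
    {C : Set (X × Y)} (hC : C ∈ cylinderAlgebra X Y) {ε : ℝ} (hε : 0 < ε) :
    ∃ u : C(X × Y, ℝ), (∀ z, u z ∈ Icc 0 1) ∧
      ∀ ρ : Measure (X × Y), IsCoupling μ ν ρ → ∫ z, |C.indicator 1 z - u z| ∂ρ ≤ ε := by
  have hint : ∀ {C : Set (X × Y)}, MeasurableSet C → ∀ (u : C(X × Y, ℝ)) (ρ : Measure (X × Y)),
      IsCoupling μ ν ρ → Integrable (fun z => |C.indicator 1 z - u z|) ρ := by
    intro C hC u ρ hρ
    have : IsProbabilityMeasure ρ := hρ.isProbabilityMeasure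
    refine (((integrable_const (1 : ℝ)).indicator hC).sub ?_).abs
    exact u.continuous.integrable_of_hasCompactSupport (HasCompactSupport.of_compactSpace _)
  induction hC generalizing ε with
  | base C hC =>
    rcases hC with ⟨A, hA, rfl⟩ | ⟨A, hA, rfl⟩
    · obtain ⟨u, hu, huε⟩ := exists_continuous_integral_indicator_sub_le μ hA hε
      refine ⟨u.comp ⟨Prod.fst, continuous_fst⟩, fun z => hu z.1, fun ρ hρ => ?_⟩
      rw [← hρ.1.map_eq, integral_map] at huε
      · exact huε
      · exact measurable_fst.aemeasurable
      · exact ((measurable_one.indicator hA).sub u.continuous.measurable).abs.aestronglyMeasurable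
    · obtain ⟨u, hu, huε⟩ := exists_continuous_integral_indicator_sub_le ν hA hε
      refine ⟨u.comp ⟨Prod.snd, continuous_snd⟩, fun z => hu z.2, fun ρ hρ => ?_⟩
      rw [← hρ.2.map_eq, integral_map] at huε
      · exact huε
      · exact measurable_snd.aemeasurable
      · exact ((measurable_one.indicator hA).sub u.continuous.measurable).abs.aestronglyMeasurable
  | empty => exact ⟨0, fun z => by simp, fun ρ _ => by simp [hε.le]⟩
  | compl C _ ih =>
    obtain ⟨u, hu, huε⟩ := ih hε
    refine ⟨1 - u, fun z => ⟨by simpa using (hu z).2, by simpa using (hu z).1⟩, fun ρ hρ => ?_⟩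
    refine le_of_eq_of_le (integral_congr_ae (.of_forall fun z => ?_)) (huε ρ hρ)
    by_cases hz : z ∈ C
    · simp [hz, abs_sub_comm]
    · simp [hz]
  | union C D hC hD ihC ihD =>
    obtain ⟨u, hu, huε⟩ := ihC (half_pos hε)
    obtain ⟨v, hv, hvε⟩ := ihD (half_pos hε)
    refine ⟨u + v - u * v, fun z => ?_, fun ρ hρ => ?_⟩
    · have h1 := hu z
      have h2 := hv z
      simp only [ContinuousMap.coe_sub, ContinuousMap.coe_add, ContinuousMap.coe_mul,
        Pi.sub_apply, Pi.add_apply, Pi.mul_apply]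
      constructor <;> nlinarith [h1.1, h1.2, h2.1, h2.2]
    · have hC := MeasurableSet.of_mem_cylinderAlgebra hC
      have hD := MeasurableSet.of_mem_cylinderAlgebra hD
      calc _ ≤ ∫ z, (|C.indicator 1 z - u z| + |D.indicator 1 z - v z|) ∂ρ := by
            refine integral_mono (hint (hC.union hD) _ ρ hρ)
              ((hint hC u ρ hρ).add (hint hD v ρ hρ)) fun z => ?_
            have h1 := hu z
            have h2 := hv z
            have hCD : (C ∪ D).indicator (1 : X × Y → ℝ) z = C.indicator 1 z + D.indicator 1 z
                - C.indicator 1 z * D.indicator 1 z := by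
              by_cases hzC : z ∈ C <;> by_cases hzD : z ∈ D <;> simp [hzC, hzD]
            have hd : D.indicator (1 : X × Y → ℝ) z ∈ Icc 0 1 := by
              by_cases hzD : z ∈ D <;> simp [hzD]
            simp only [hCD, ContinuousMap.coe_sub, ContinuousMap.coe_add, ContinuousMap.coe_mul,
              Pi.sub_apply, Pi.add_apply, Pi.mul_apply]
            set c := C.indicator (1 : X × Y → ℝ) z
            set d := D.indicator (1 : X × Y → ℝ) z
            have : c + d - c * d - (u z + v z - u z * v z) =
              (c - u z) * (1 - d) + (d - v z) * (1 - u z) := by ring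
            rw [this]
            refine (abs_add_le _ _).trans (add_le_add ?_ ?_)
            · rw [abs_mul]
              exact mul_le_of_le_one_right (abs_nonneg _)
                (abs_le.2 ⟨by linarith [hd.2], by linarith [hd.1]⟩)
            · rw [abs_mul]
              exact mul_le_of_le_one_right (abs_nonneg _)
                (abs_le.2 ⟨by linarith [h1.2], by linarith [h1.1]⟩)
        _ = _ := integral_add (hint hC u ρ hρ) (hint hD v ρ hρ)
        _ ≤ ε / 2 + ε / 2 := add_le_add (huε ρ hρ) (hvε ρ hρ)
        _ = ε := add_halves ε

theorem measurePreserving_of_tendsto {Z : Type*} [TopologicalSpace Z] [MeasurableSpace Z]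
    [BorelSpace Z] [TopologicalSpace X] [HasOuterApproxClosed X] [BorelSpace X]
    [IsProbabilityMeasure μ] {ι : Type*} {l : Filter ι} [NeBot l] {P : ι → ProbabilityMeasure Z}
    {R : ProbabilityMeasure Z} (hR : Tendsto P l (𝓝 R)) {q : Z → X} (hq : Continuous q)
    (hP : ∀ i, MeasurePreserving q (P i : Measure Z) μ) :
    MeasurePreserving q (R : Measure Z) μ := by
  refine ⟨hq.measurable, ?_⟩
  let M : ProbabilityMeasure X := ⟨μ, inferInstance⟩
  have h1 := ProbabilityMeasure.tendsto_map_of_tendsto_of_continuous P R hR hq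
  have h2 : ∀ i, (P i).map hq.measurable.aemeasurable = M := fun i => Subtype.ext (hP i).map_eq
  simp only [h2] at h1
  have h3 : M = R.map hq.measurable.aemeasurable := tendsto_nhds_unique tendsto_const_nhds h1
  exact (congrArg Subtype.val h3).symm

theorem exists_coupling_tendsto_of_compact [TopologicalSpace X] [CompactSpace X]
    [MetrizableSpace X] [BorelSpace X] [TopologicalSpace Y] [CompactSpace Y]
    [MetrizableSpace Y] [BorelSpace Y] [IsProbabilityMeasure μ] [IsProbabilityMeasure ν]
    {ι : Type*} (𝒰 : Ultrafilter ι) {ρ : ι → Measure (X × Y)} (hρ : ∀ i, IsCoupling μ ν (ρ i)) :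
    ∃ r : Measure (X × Y), IsCoupling μ ν r ∧
      ∀ C ∈ cylinderAlgebra X Y, Tendsto (fun i => (ρ i).real C) 𝒰 (𝓝 (r.real C)) := by
  have hprob : ∀ i, IsProbabilityMeasure (ρ i) := fun i => (hρ i).isProbabilityMeasure
  let P : ι → ProbabilityMeasure (X × Y) := fun i => ⟨ρ i, hprob i⟩
  obtain ⟨R, -, hR⟩ := isCompact_univ.ultrafilter_le_nhds (𝒰.map P) (by simp)
  have hR : Tendsto P 𝒰 (𝓝 R) := hR
  have hr : IsCoupling μ ν (R : Measure (X × Y)) :=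
    ⟨measurePreserving_of_tendsto hR continuous_fst fun i => (hρ i).1,
      measurePreserving_of_tendsto hR continuous_snd fun i => (hρ i).2⟩
  refine ⟨R, hr, fun C hC => ?_⟩
  have hCm := MeasurableSet.of_mem_cylinderAlgebra hC
  rw [Metric.tendsto_nhds]
  intro ε hε
  obtain ⟨u, hu, huε⟩ := IsCoupling.exists_continuous_approx (μ := μ) (ν := ν) hC
    (show 0 < ε / 4 by positivity)
  have hdiff : ∀ r : Measure (X × Y), IsCoupling μ ν r → |r.real C - ∫ z, u z ∂r| ≤ ε / 4 := by
    intro r hr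
    have : IsProbabilityMeasure r := hr.isProbabilityMeasure
    rw [← integral_indicator_one hCm, ← integral_sub]
    · exact abs_integral_le_integral_abs.trans (huε r hr)
    · exact (integrable_const (1 : ℝ)).indicator hCm
    · exact u.continuous.integrable_of_hasCompactSupport (HasCompactSupport.of_compactSpace _)
  have hconv := (ProbabilityMeasure.tendsto_iff_forall_integral_tendsto.1 hR)
    (BoundedContinuousFunction.mkOfCompact u)
  filter_upwards [Metric.tendsto_nhds.1 hconv (ε / 4) (by positivity)] with i hi
  have a1 := hdiff (ρ i) (hρ i)
  have a2 := hdiff R hr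
  change |(∫ z, u z ∂(ρ i)) - ∫ z, u z ∂(R : Measure (X × Y))| < ε / 4 at hi
  rw [Real.dist_eq]
  rw [abs_le] at a1 a2
  rw [abs_lt] at hi ⊢
  constructor <;> linarith [a1.1, a1.2, a2.1, a2.2, hi.1, hi.2]

/-- The couplings of two atomless standard probability measures are compact for convergence on
measurable rectangles, and not only for weak convergence. -/
theorem exists_coupling_tendsto [StandardBorelSpace X] [StandardBorelSpace Y]
    [IsProbabilityMeasure μ] [IsProbabilityMeasure ν] [NullSingletonClass μ]
    [NullSingletonClass ν]
    {ι : Type*} (𝒰 : Ultrafilter ι) {ρ : ι → Measure (X × Y)} (hρ : ∀ i, IsCoupling μ ν (ρ i)) :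
    ∃ r : Measure (X × Y), IsCoupling μ ν r ∧
      ∀ C ∈ cylinderAlgebra X Y, Tendsto (fun i => (ρ i).real C) 𝒰 (𝓝 (r.real C)) := by
  obtain ⟨_, _, _, _⟩ := exists_compact_metrizable_borelSpace X
    (not_countable_of_nullSingletonClass μ)
  obtain ⟨_, _, _, _⟩ := exists_compact_metrizable_borelSpace Y
    (not_countable_of_nullSingletonClass ν)
  exact exists_coupling_tendsto_of_compact 𝒰 hρ

end

/-! ### The limit of the graph joinings -/

section

theorem image_preimage_eq_of_semiconj {X Y : Type*} {g : Equiv.Perm X} {f : Equiv.Perm Y}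
    {Ψ : X → Y} (h : ∀ x, Ψ (g x) = f (Ψ x)) (C : Set Y) : g '' (Ψ ⁻¹' C) = Ψ ⁻¹' (f '' C) := by
  ext x
  obtain ⟨x, rfl⟩ := g.surjective x
  simp [h]

theorem PMPAction.hasFactor_of_semiconj {S X : Type*} [MeasurableSpace X] {μ : Measure X}
    {g h : S → MPIso μ} {Φ : X → X} (hΦ : MeasurePreserving Φ μ μ)
    (hs : ∀ s x, Φ ((g s).1 x) = (h s).1 (Φ x)) :
    PMPAction.HasFactor (fun s => MPAut.mk (g s)) (fun s => MPAut.mk (h s)) := by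
  refine ⟨Φ, hΦ, fun γ a b ha hb => ?_⟩
  have key : ∀ γ : FreeGroup S, ∀ x,
      Φ ((FreeGroup.lift g γ).1 x) = (FreeGroup.lift h γ).1 (Φ x) := by
    intro γ
    induction γ using FreeGroup.induction_on with
    | C1 => intro x; simp
    | of s => intro x; simpa using hs s x
    | inv_of s _ =>
      intro x
      rw [map_inv, map_inv, FreeGroup.lift_apply_of, FreeGroup.lift_apply_of]
      change Φ ((g s).1.symm x) = (h s).1.symm (Φ x)
      rw [Equiv.eq_symm_apply, ← hs s, Equiv.apply_symm_apply]
    | mul γ δ hγ hδ =>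
      intro x
      rw [map_mul, map_mul]
      exact (hγ _).trans (congrArg _ (hδ x))
  have hlift : ∀ k : S → MPIso μ, PMPAction.act (fun s => MPAut.mk (k s)) γ =
      MPAut.mk (FreeGroup.lift k γ) := fun k =>
    DFunLike.congr_fun (FreeGroup.ext_hom (PMPAction.act fun s => MPAut.mk (k s))
      (MPAut.mk.comp (FreeGroup.lift k)) fun s => by simp [PMPAction.act]) γ
  rw [hlift, MPAut.mk_eq_mk_iff] at ha hb
  filter_upwards [ha, hΦ.quasiMeasurePreserving.ae hb] with x hx hx'
  rw [hx, hx', key]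

variable {X : Type*} [MeasurableSpace X] {μ : Measure X}

theorem isCoupling_map_graph {φ : X → X} (hφ : MeasurePreserving φ μ μ) :
    IsCoupling μ μ (μ.map fun x => (x, φ x)) := by
  have hm : Measurable fun x => (x, φ x) := measurable_id.prodMk hφ.measurable
  refine ⟨⟨measurable_fst, ?_⟩, ⟨measurable_snd, ?_⟩⟩
  · rw [Measure.map_map measurable_fst hm]
    exact Measure.map_id
  · rw [Measure.map_map measurable_snd hm]
    exact hφ.map_eq

theorem prodCongr_image_mem_cylinderAlgebra (f h : MPIso μ) {C : Set (X × X)}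
    (hC : C ∈ cylinderAlgebra X X) : f.1.prodCongr h.1 '' C ∈ cylinderAlgebra X X := by
  induction hC with
  | base C hC =>
    refine generateSetAlgebra.base _ ?_
    rcases hC with ⟨A, hA, rfl⟩ | ⟨A, hA, rfl⟩
    · exact Or.inl ⟨_, MPIso.measurableSet_image f hA,
        image_preimage_eq_of_semiconj (g := f.1.prodCongr h.1)
          (f := f.1) (Ψ := Prod.fst) (fun _ => rfl) A⟩
    · exact Or.inr ⟨_, MPIso.measurableSet_image h hA,
        image_preimage_eq_of_semiconj (g := f.1.prodCongr h.1)
          (f := h.1) (Ψ := Prod.snd) (fun _ => rfl) A⟩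
  | empty =>
    rw [image_empty]
    exact generateSetAlgebra.empty
  | compl C _ ih =>
    rw [image_compl_eq (Equiv.bijective _)]
    exact ih.compl
  | union C D _ _ ihC ihD =>
    rw [image_union]
    exact ihC.union _ _ ihD

/-- If the conjugates of `f` by `φ i` converge to `h`, then the graph maps `x ↦ (x, φ i x)`
asymptotically intertwine `f` with `f × h` on the cylinder algebra. -/
theorem tendsto_symmDiff_graph [IsProbabilityMeasure μ] {f h : MPIso μ} {ι : Type*}
    {l : Filter ι} {φ : ι → MPIso μ}
    (hφ : Tendsto (fun i => MPAut.mk (φ i * f * (φ i)⁻¹)) l (𝓝 (MPAut.mk h)))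
    {C : Set (X × X)} (hC : C ∈ cylinderAlgebra X X) :
    Tendsto (fun i => μ.real ((f.1 '' ((fun x => (x, (φ i).1 x)) ⁻¹' C)) ∆
      ((fun x => (x, (φ i).1 x)) ⁻¹' (f.1.prodCongr h.1 '' C)))) l (𝓝 0) := by
  induction hC with
  | base C hC =>
    rcases hC with ⟨A, hA, rfl⟩ | ⟨A, hA, rfl⟩
    · have h1 : f.1.prodCongr h.1 '' (Prod.fst ⁻¹' A) = Prod.fst ⁻¹' (f.1 '' A) :=
        image_preimage_eq_of_semiconj (g := f.1.prodCongr h.1)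
          (f := f.1) (Ψ := Prod.fst) (fun _ => rfl) A
      rw [h1]
      refine tendsto_const_nhds.congr fun i => ?_
      rw [← preimage_comp, ← preimage_comp]
      change 0 = μ.real ((f.1 '' A) ∆ (f.1 '' A))
      simp
    · have h1 : f.1.prodCongr h.1 '' (Prod.snd ⁻¹' A) = Prod.snd ⁻¹' (h.1 '' A) :=
        image_preimage_eq_of_semiconj (g := f.1.prodCongr h.1)
          (f := h.1) (Ψ := Prod.snd) (fun _ => rfl) A
      rw [h1]
      have h2 := (ENNReal.tendsto_toReal ENNReal.zero_ne_top).comp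
        (MPAut.tendsto_mk_iff.1 hφ A hA)
      refine h2.congr fun i => ?_
      change μ.real _ = μ.real ((f.1 '' ((φ i).1 ⁻¹' A)) ∆ ((φ i).1 ⁻¹' (h.1 '' A)))
      have h3 : (φ i * f * (φ i)⁻¹).1 '' A = (φ i).1 '' (f.1 '' ((φ i).1 ⁻¹' A)) := by
        rw [← Equiv.image_symm_eq_preimage]
        simp only [image_image]; rfl
      have h4 : h.1 '' A = (φ i).1 '' ((φ i).1 ⁻¹' (h.1 '' A)) :=
        ((φ i).1.image_preimage _).symm
      rw [h3]
      nth_rewrite 1 [h4]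
      rw [Measure.real, MPIso.measure_image_symmDiff, Measure.real]
      · exact MPIso.measurableSet_image f ((φ i).2.1.measurable hA)
      · exact (φ i).2.1.measurable (MPIso.measurableSet_image h hA)
  | empty => simpa using tendsto_const_nhds
  | compl C _ ih =>
    refine ih.congr fun i => ?_
    rw [image_compl_eq (Equiv.bijective _), preimage_compl, preimage_compl,
      image_compl_eq (Equiv.bijective _), compl_symmDiff_compl]
  | union C D _ _ ihC ihD =>
    have := ihC.add ihD
    rw [add_zero] at this
    refine squeeze_zero (fun _ => measureReal_nonneg) (fun i => ?_) this
    rw [image_union, preimage_union, preimage_union, image_union]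
    refine (measureReal_mono ?_).trans (measureReal_union_le _ _)
    exact union_symmDiff_union_subset

variable [StandardBorelSpace X] [IsProbabilityMeasure μ] [NullSingletonClass μ]

/-- The action `g` is `f × h` on the limit `r` of the graph joinings of the conjugating
automorphisms, transported to `(X, μ)`. -/
theorem PMPAction.WeaklyContains.exists_weaklyEquivalent_hasFactor {S : Type*} [Finite S]
    {f h : PMPAction S μ} (hfh : f.WeaklyContains h) :
    ∃ g : PMPAction S μ, g.WeaklyEquivalent f ∧ g.HasFactor h := by
  choose f' hf' using fun s => MPAut.mk_surjective (f s)
  choose h' hh' using fun s => MPAut.mk_surjective (h s)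
  obtain rfl : (fun s => MPAut.mk (f' s)) = f := funext hf'
  obtain rfl : (fun s => MPAut.mk (h' s)) = h := funext hh'
  have hmem : (fun s => MPAut.mk (h' s)) ∈ PMPAction.conjClass (fun s => MPAut.mk (h' s)) :=
    ⟨1, fun s => by simp⟩
  obtain ⟨𝒰, h𝒰f, h𝒰h⟩ := mem_closure_iff_ultrafilter.1 (hfh hmem)
  -- a conjugating automorphism for each point `k` of the conjugacy class, a junk value elsewhere
  have hex : ∀ k : PMPAction S μ, ∃ φ : MPIso μ,
      k ∈ PMPAction.conjClass (fun s => MPAut.mk (f' s)) →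
        ∀ s, k s = MPAut.mk (φ * f' s * φ⁻¹) := by
    intro k
    by_cases hk : k ∈ PMPAction.conjClass (fun s => MPAut.mk (f' s))
    · obtain ⟨φ, hφ⟩ := hk
      obtain ⟨φ, rfl⟩ := MPAut.mk_surjective φ
      exact ⟨φ, fun _ s => by simp [hφ]⟩
    · exact ⟨1, fun h => absurd h hk⟩
  choose φ hφ using hex
  have hconv : ∀ s, Tendsto (fun k => MPAut.mk (φ k * f' s * (φ k)⁻¹)) 𝒰
      (𝓝 (MPAut.mk (h' s))) := fun s =>
    Tendsto.congr' (by filter_upwards [h𝒰f] with k hk using hφ k hk s)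
      ((tendsto_pi_nhds.1 (tendsto_id.mono_left h𝒰h)) s)
  have hgm : ∀ k, Measurable fun x => (x, (φ k).1 x) := fun k =>
    measurable_id.prodMk (φ k).2.1.measurable
  obtain ⟨r, hr, hrC⟩ := exists_coupling_tendsto 𝒰 fun k => isCoupling_map_graph (φ k).2.1
  replace hrC : ∀ C ∈ cylinderAlgebra X X,
      Tendsto (fun k => μ.real ((fun x => (x, (φ k).1 x)) ⁻¹' C)) 𝒰 (𝓝 (r.real C)) :=
    fun C hC => (hrC C hC).congr fun k =>
      map_measureReal_apply (hgm k) (MeasurableSet.of_mem_cylinderAlgebra hC)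
  have hrp := hr.isProbabilityMeasure
  have hrn : NullSingletonClass r := ⟨fun z => by
    refine measure_mono_null (t := Prod.fst ⁻¹' {z.1}) (by rintro _ rfl; rfl) ?_
    rw [hr.1.measure_preimage (measurableSet_singleton _).nullMeasurableSet, measure_singleton]⟩
  -- the product action preserves `r`: on rectangles this is the limit of the same statement for
  -- the graph joinings, where it holds asymptotically
  let G : S → X × X ≃ᵐ X × X := fun s =>
    { toEquiv := (f' s).1.prodCongr (h' s).1
      measurable_toFun := (f' s).2.1.measurable.prodMap (h' s).2.1.measurable
      measurable_invFun := (f' s).2.2.measurable.prodMap (h' s).2.2.measurable }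
  have hGsymm : ∀ s, MeasurePreserving (G s).symm r r := by
    intro s
    refine ⟨(G s).symm.measurable, (ext_of_generate_finite _ (generateFrom_cylinderAlgebra X X)
      (isSetAlgebra_cylinderAlgebra X X).isSetRing.isSetSemiring.isPiSystem ?_ ?_).symm⟩
    · intro C hC
      have hCm := MeasurableSet.of_mem_cylinderAlgebra hC
      have hGC := prodCongr_image_mem_cylinderAlgebra (f' s) (h' s) hC
      rw [(G s).symm.map_apply, ← (G s).image_eq_preimage_symm]
      refine (measureReal_eq_measureReal_iff).1 (tendsto_nhds_unique (hrC C hC) ?_)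
      have h1 := hrC _ hGC
      refine h1.congr_dist ?_
      refine squeeze_zero (fun _ => dist_nonneg) (fun k => ?_)
        (tendsto_symmDiff_graph (hconv s) hC)
      set A := (fun x => (x, (φ k).1 x)) ⁻¹' C
      set B := (fun x => (x, (φ k).1 x)) ⁻¹' ((f' s).1.prodCongr (h' s).1 '' C)
      have hA : MeasurableSet A := hgm k hCm
      have hfA : μ.real A = μ.real ((f' s).1 '' A) := by
        rw [Measure.real, Measure.real, MPIso.measure_image _ hA]
      rw [hfA, Real.dist_eq, abs_sub_comm]
      exact abs_measureReal_sub_le_measureReal_symmDiff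
        (MPIso.measurableSet_image _ hA).nullMeasurableSet
        (hgm k (MeasurableSet.of_mem_cylinderAlgebra hGC)).nullMeasurableSet
    · rw [(G s).symm.map_apply, preimage_univ]
  have hG : ∀ s, MeasurePreserving (G s) r r := fun s => (hGsymm s).symm (G s).symm
  obtain ⟨θ, hθ⟩ := exists_measurePreserving_equiv r μ
  have hθs := hθ.symm θ
  let g : S → MPIso μ := fun s =>
    ⟨(θ.symm.trans ((G s).trans θ)).toEquiv, hθ.comp ((hG s).comp hθs),
      hθ.comp ((hGsymm s).comp hθs)⟩
  have hg1 : ∀ s x, (θ.symm ((g s).1 x)).1 = (f' s).1 (θ.symm x).1 := fun s x =>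
    congrArg Prod.fst (θ.symm_apply_apply (G s (θ.symm x)))
  have hg2 : ∀ s x, (θ.symm ((g s).1 x)).2 = (h' s).1 (θ.symm x).2 := fun s x =>
    congrArg Prod.snd (θ.symm_apply_apply (G s (θ.symm x)))
  have hgθ : ∀ s C, (g s).1 '' (θ.symm ⁻¹' C) = θ.symm ⁻¹' ((f' s).1.prodCongr (h' s).1 '' C) :=
    fun s C => image_preimage_eq_of_semiconj (fun x => θ.symm_apply_apply _) C
  refine ⟨fun s => MPAut.mk (g s), ⟨?_, ?_⟩,
    PMPAction.hasFactor_of_semiconj (hr.2.comp hθs) hg2⟩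
  · -- `f` is a factor of `g`, so a single intertwining map serves as the net of the criterion
    have hΨ : MeasurePreserving (fun x => (θ.symm x).1) μ μ := hr.1.comp hθs
    refine PMPAction.weaklyContains_of_tendsto g f' (𝒜 := {C | MeasurableSet C})
      ⟨.empty, fun _ h => h.compl, fun _ _ h h' => h.union h'⟩
      MeasurableSpace.generateFrom_measurableSet.symm
      (fun s C hC => MPIso.measurableSet_image _ hC) (l := (pure () : Filter Unit))
      (ρ := fun _ x => (θ.symm x).1) (fun _ => hΨ.measurable) (fun C hC => ?_) (fun s C hC => ?_)
    · rw [hΨ.measureReal_preimage hC.nullMeasurableSet]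
      exact tendsto_const_nhds
    · rw [image_preimage_eq_of_semiconj (hg1 s)]
      simp
  · -- the graph maps, followed by `θ`, asymptotically intertwine `f` with `g`
    refine PMPAction.weaklyContains_of_tendsto f' g
      (𝒜 := preimage θ.symm '' cylinderAlgebra X X) ⟨?_, ?_, ?_⟩ ?_ ?_ (l := (𝒰 : Filter _))
      (ρ := fun k x => θ (x, (φ k).1 x)) (fun k => θ.measurable.comp (hgm k)) ?_ ?_
    · exact ⟨∅, (isSetAlgebra_cylinderAlgebra X X).empty_mem, preimage_empty⟩
    · rintro _ ⟨C, hC, rfl⟩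
      exact ⟨Cᶜ, (isSetAlgebra_cylinderAlgebra X X).compl_mem hC, preimage_compl⟩
    · rintro _ _ ⟨C, hC, rfl⟩ ⟨D, hD, rfl⟩
      exact ⟨C ∪ D, (isSetAlgebra_cylinderAlgebra X X).union_mem hC hD, preimage_union⟩
    · rw [← MeasurableSpace.comap_generateFrom, ← generateFrom_cylinderAlgebra]
      exact θ.symm.measurableEmbedding.comap_eq.symm
    · rintro s _ ⟨C, hC, rfl⟩
      rw [hgθ]
      exact mem_image_of_mem _ (prodCongr_image_mem_cylinderAlgebra _ _ hC)
    · rintro _ ⟨C, hC, rfl⟩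
      rw [hθs.measureReal_preimage (MeasurableSet.of_mem_cylinderAlgebra hC).nullMeasurableSet]
      refine (hrC C hC).congr fun k => ?_
      rw [← preimage_comp]
      simp [Function.comp_def]
    · rintro s _ ⟨C, hC, rfl⟩
      refine (tendsto_symmDiff_graph (hconv s) hC).congr fun k => ?_
      rw [hgθ, ← preimage_comp, ← preimage_comp]
      simp [Function.comp_def]

end

/-! ### Hilbert dimension and approximate orthonormality -/

section HilbertDimension

variable {H K : Type*} [NormedAddCommGroup H] [InnerProductSpace ℂ H]
  [NormedAddCommGroup K] [InnerProductSpace ℂ K]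

theorem Orthonormal.countable_of_separableSpace [SeparableSpace H] {ι : Type*} {v : ι → H}
    (hv : Orthonormal ℂ v) : Countable ι := by
  rw [← countable_univ_iff]
  refine PairwiseDisjoint.countable_of_isOpen (s := fun i => Metric.ball (v i) (1 / 2)) ?_
    (fun i _ => Metric.isOpen_ball) (fun i _ => ⟨v i, Metric.mem_ball_self (by norm_num)⟩)
  intro i _ j _ hij
  refine Metric.ball_disjoint_ball ?_
  have h1 : ‖v i - v j‖ ^ 2 = 2 := by
    rw [@norm_sub_sq ℂ, hv.1 i, hv.1 j, hv.2 hij]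
    norm_num
  rw [dist_eq_norm]
  nlinarith [norm_nonneg (v i - v j)]

theorem HilbertBasis.finiteDimensional_of_finite {ι : Type*} [Finite ι]
    (b : HilbertBasis ι ℂ H) : FiniteDimensional ℂ H := by
  have := Fintype.ofFinite ι
  exact b.toOrthonormalBasis.toBasis.finiteDimensional_of_finite

theorem HilbertBasis.nonempty_linearIsometryEquiv_of_equiv [CompleteSpace H]
    {ι κ : Type*} (b : HilbertBasis ι ℂ H)
    (c : HilbertBasis κ ℂ K) (e : κ ≃ ι) : Nonempty (K ≃ₗᵢ[ℂ] H) := by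
  have hsp : ⊤ ≤ (Submodule.span ℂ (range (b ∘ e))).topologicalClosure := by
    rw [e.surjective.range_comp, b.dense_span]
  exact ⟨c.repr.trans (HilbertBasis.mk (b.orthonormal.comp e e.injective) hsp).repr.symm⟩

/-- Separable Hilbert spaces `H` and `K` are isomorphic if `H` embeds in `K` and no finite
orthonormal system of `K` is longer than those of `H`. -/
theorem nonempty_linearIsometryEquiv_of_orthonormal [CompleteSpace H] [CompleteSpace K]
    [SeparableSpace H] [SeparableSpace K]
    (D : H →ₗᵢ[ℂ] K)
    (hK : ∀ (n : ℕ) (v : Fin n → K), Orthonormal ℂ v → ∃ w : Fin n → H, Orthonormal ℂ w) :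
    Nonempty (K ≃ₗᵢ[ℂ] H) := by
  obtain ⟨s, b, -⟩ := exists_hilbertBasis ℂ H
  obtain ⟨t, c, -⟩ := exists_hilbertBasis ℂ K
  have := b.orthonormal.countable_of_separableSpace
  have := c.orthonormal.countable_of_separableSpace
  by_cases hH : FiniteDimensional ℂ H
  · have hle : ∀ (n : ℕ) (v : Fin n → K), Orthonormal ℂ v → n ≤ Module.finrank ℂ H := by
      intro n v hv
      obtain ⟨w, hw⟩ := hK n v hv
      simpa using hw.linearIndependent.fintype_card_le_finrank
    have ht : Finite t := by
      by_contra ht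
      rw [not_finite_iff_infinite] at ht
      have := hle (Module.finrank ℂ H + 1)
        (fun i => c (Infinite.natEmbedding t i))
        (c.orthonormal.comp (fun i : Fin (Module.finrank ℂ H + 1) => Infinite.natEmbedding t i)
          ((Infinite.natEmbedding t).injective.comp Fin.val_injective))
      omega
    have := c.finiteDimensional_of_finite
    have h1 := hle _ _ (stdOrthonormalBasis ℂ K).orthonormal
    have h2 := LinearMap.finrank_le_finrank_of_injective (f := D.toLinearMap) D.injective
    exact ⟨(stdOrthonormalBasis ℂ K).equiv (stdOrthonormalBasis ℂ H)
      (finCongr (le_antisymm h1 h2))⟩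
  · have hs : Infinite s := not_finite_iff_infinite.1 fun h => hH b.finiteDimensional_of_finite
    have ht : Infinite t := not_finite_iff_infinite.1 fun h => hH <| by
      have := c.finiteDimensional_of_finite
      exact Module.Finite.of_injective D.toLinearMap D.injective
    exact b.nonempty_linearIsometryEquiv_of_equiv c (nonempty_equiv_of_countable (α := t)).some

end HilbertDimension

section GramSchmidt

open InnerProductSpace

variable {H : Type*} [NormedAddCommGroup H] [InnerProductSpace ℂ H]

theorem tendsto_norm_one_of_inner {ι : Type*} {l : Filter ι} {w : ι → H}
    (h : Tendsto (fun m => (inner ℂ (w m) (w m) : ℂ)) l (𝓝 1)) :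
    Tendsto (fun m => ‖w m‖) l (𝓝 1) := by
  have h2 := (Real.continuous_sqrt.tendsto _).comp ((Complex.continuous_re.tendsto _).comp h)
  simp only [Complex.one_re, Real.sqrt_one] at h2
  exact h2.congr fun m => (norm_eq_sqrt_re_inner (𝕜 := ℂ) (w m)).symm

/-- The Gram-Schmidt process moves a tuple by little if its Gram matrix is close to the identity. -/
theorem tendsto_gramSchmidt_sub {n : ℕ} {ι : Type*} {l : Filter ι} {w : ι → Fin n → H}
    (h : ∀ i j, Tendsto (fun m => (inner ℂ (w m i) (w m j) : ℂ)) l (𝓝 (if i = j then 1 else 0)))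
    (i : Fin n) : Tendsto (fun m => gramSchmidt ℂ (w m) i - w m i) l (𝓝 0) := by
  have hw : ∀ i, Tendsto (fun m => ‖w m i‖) l (𝓝 1) := fun i =>
    tendsto_norm_one_of_inner (by simpa using h i i)
  induction i using WellFoundedLT.induction with
  | ind i ih =>
    have hterm : ∀ j ∈ Finset.Iio i, Tendsto (fun m =>
        (inner ℂ (gramSchmidt ℂ (w m) j) (w m i) / (‖gramSchmidt ℂ (w m) j‖ : ℂ) ^ 2) •
          gramSchmidt ℂ (w m) j) l (𝓝 0) := by
      intro j hj
      have hji : j < i := Finset.mem_Iio.1 hj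
      have h0 := tendsto_zero_iff_norm_tendsto_zero.1 (ih j hji)
      have h1 : Tendsto (fun m => ‖gramSchmidt ℂ (w m) j‖) l (𝓝 1) := by
        refine (hw j).congr_dist (squeeze_zero (fun _ => dist_nonneg) (fun m => ?_) h0)
        rw [dist_comm, Real.dist_eq]
        exact abs_norm_sub_norm_le _ _
      have h2 : Tendsto (fun m => (inner ℂ (gramSchmidt ℂ (w m) j) (w m i) : ℂ)) l (𝓝 0) := by
        have a1 : Tendsto (fun m => (inner ℂ (gramSchmidt ℂ (w m) j - w m j) (w m i) : ℂ)) l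
            (𝓝 0) := by
          refine squeeze_zero_norm (fun m => norm_inner_le_norm _ _) ?_
          simpa using h0.mul (hw i)
        have a2 := a1.add (h j i)
        rw [if_neg hji.ne, add_zero] at a2
        exact a2.congr fun m => by rw [← inner_add_left, sub_add_cancel]
      rw [tendsto_zero_iff_norm_tendsto_zero]
      have h3 := ((tendsto_zero_iff_norm_tendsto_zero.1 h2).div (h1.pow 2) (by norm_num)).mul h1
      simp only [one_pow, div_one, mul_one] at h3
      refine h3.congr fun m => ?_
      rw [norm_smul, norm_div, norm_pow, Complex.norm_real, norm_norm]
      rfl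
    have hsum := (tendsto_finsetSum _ hterm).neg
    simp only [Finset.sum_const_zero, neg_zero] at hsum
    refine hsum.congr fun m => ?_
    rw [neg_eq_iff_eq_neg, neg_sub]
    exact (sub_eq_of_eq_add' (gramSchmidt_def'' ℂ (w m) i)).symm

/-- Tuples whose Gram matrices converge to the identity are asymptotic to orthonormal tuples. -/
theorem exists_orthonormal_of_tendsto {n : ℕ} {ι : Type*} {l : Filter ι} {w : ι → Fin n → H}
    (h : ∀ i j, Tendsto (fun m => (inner ℂ (w m i) (w m j) : ℂ)) l (𝓝 (if i = j then 1 else 0))) :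
    ∃ u : ι → Fin n → H, (∀ᶠ m in l, Orthonormal ℂ (u m)) ∧
      ∀ i, Tendsto (fun m => u m i - w m i) l (𝓝 0) := by
  have hw : ∀ i, Tendsto (fun m => ‖w m i‖) l (𝓝 1) := fun i =>
    tendsto_norm_one_of_inner (by simpa using h i i)
  have hg := tendsto_gramSchmidt_sub h
  have hgn : ∀ j, Tendsto (fun m => ‖gramSchmidt ℂ (w m) j‖) l (𝓝 1) := by
    intro j
    refine (hw j).congr_dist (squeeze_zero (fun _ => dist_nonneg) (fun m => ?_)
      (tendsto_zero_iff_norm_tendsto_zero.1 (hg j)))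
    rw [dist_comm, Real.dist_eq]
    exact abs_norm_sub_norm_le _ _
  refine ⟨fun m => gramSchmidtNormed ℂ (w m), ?_, fun i => ?_⟩
  · have : ∀ᶠ m in l, ∀ j, 0 < ‖gramSchmidt ℂ (w m) j‖ :=
      eventually_all.2 fun j => (hgn j).eventually_const_lt one_pos
    filter_upwards [this] with m hm
    have hne : ∀ j, gramSchmidtNormed ℂ (w m) j ≠ 0 := fun j => by
      rw [gramSchmidtNormed]
      exact smul_ne_zero (by simpa using hm j) (norm_pos_iff.1 (hm j))
    exact (gramSchmidtNormed_orthonormal' (𝕜 := ℂ) (w m)).comp (fun j => ⟨j, hne j⟩)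
      fun a b hab => congrArg Subtype.val hab
  · have h1 : Tendsto (fun m => gramSchmidtNormed ℂ (w m) i - gramSchmidt ℂ (w m) i) l (𝓝 0) := by
      rw [tendsto_zero_iff_norm_tendsto_zero]
      have h2 := (((hgn i).inv₀ one_ne_zero).sub_const 1).norm.mul (hgn i)
      simp only [inv_one, sub_self, norm_zero, zero_mul] at h2
      refine h2.congr fun m => ?_
      rw [gramSchmidtNormed]
      nth_rewrite 5 [← one_smul ℂ (gramSchmidt ℂ (w m) i)]
      rw [← sub_smul, norm_smul]
      congr 1
      rw [← Complex.norm_real]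
      simp
    simpa using h1.add (hg i)

end GramSchmidt

/-! ### Ultraproducts of Hilbert spaces -/

section Ultraproduct

variable {ι : Type*} (𝒰 : Ultrafilter ι) (H : Type*) [NormedAddCommGroup H] [InnerProductSpace ℂ H]

/-- The bounded families of vectors of `H` indexed by `ι`. -/
def boundedFamilies (ι H : Type*) [NormedAddCommGroup H] [InnerProductSpace ℂ H] :
    Submodule ℂ (ι → H) where
  carrier := {f | ∃ C, ∀ i, ‖f i‖ ≤ C}
  add_mem' := by
    rintro f g ⟨C, hC⟩ ⟨D, hD⟩
    exact ⟨C + D, fun i => (norm_add_le _ _).trans (add_le_add (hC i) (hD i))⟩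
  zero_mem' := ⟨0, fun i => by simp⟩
  smul_mem' := by
    rintro c f ⟨C, hC⟩
    refine ⟨‖c‖ * C, fun i => ?_⟩
    rw [Pi.smul_apply, norm_smul]
    exact mul_le_mul_of_nonneg_left (hC i) (norm_nonneg _)

/-- The bounded families, with the positive semidefinite inner product `lim_𝒰 ⟪f i, g i⟫`. The
Hilbert space ultraproduct is its completion, which also divides out the vectors of norm zero. -/
def PreUltraproduct {ι : Type*} (_𝒰 : Ultrafilter ι) (H : Type*) [NormedAddCommGroup H]
    [InnerProductSpace ℂ H] : Type _ := boundedFamilies ι H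

namespace PreUltraproduct

instance : AddCommGroup (PreUltraproduct 𝒰 H) :=
  inferInstanceAs (AddCommGroup (boundedFamilies ι H))
instance : Module ℂ (PreUltraproduct 𝒰 H) := inferInstanceAs (Module ℂ (boundedFamilies ι H))

variable {𝒰 H}

theorem tendsto_limUnder_inner (f g : PreUltraproduct 𝒰 H) :
    Tendsto (fun i => (inner ℂ (f.1 i) (g.1 i) : ℂ)) 𝒰
      (𝓝 (limUnder (𝒰 : Filter ι) fun i => inner ℂ (f.1 i) (g.1 i))) := by
  obtain ⟨C, hC⟩ := f.2
  obtain ⟨D, hD⟩ := g.2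
  refine tendsto_nhds_limUnder ?_
  obtain ⟨z, -, hz⟩ := (isCompact_closedBall (0 : ℂ) (C * D)).ultrafilter_le_nhds
    (𝒰.map fun i => (inner ℂ (f.1 i) (g.1 i) : ℂ)) (by
      rw [le_principal_iff]
      refine Filter.mem_map.2 (Filter.univ_mem' fun i => ?_)
      rw [mem_preimage, mem_closedBall_zero_iff]
      refine (norm_inner_le_norm _ _).trans (mul_le_mul (hC i) (hD i) (norm_nonneg _) ?_)
      exact (norm_nonneg _).trans (hC i))
  exact ⟨z, hz⟩

instance core : PreInnerProductSpace.Core ℂ (PreUltraproduct 𝒰 H) where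
  inner f g := limUnder (𝒰 : Filter ι) fun i => inner ℂ (f.1 i) (g.1 i)
  conj_inner_symm f g := by
    refine tendsto_nhds_unique ((Complex.continuous_conj.tendsto _).comp
      (tendsto_limUnder_inner g f)) ?_
    exact (tendsto_limUnder_inner f g).congr fun i => (inner_conj_symm _ _).symm
  re_inner_nonneg f :=
    ge_of_tendsto' ((Complex.continuous_re.tendsto _).comp (tendsto_limUnder_inner f f))
      fun i => inner_self_nonneg (𝕜 := ℂ)
  add_left f g h := by
    refine tendsto_nhds_unique (tendsto_limUnder_inner (f + g) h) ?_
    exact ((tendsto_limUnder_inner f h).add (tendsto_limUnder_inner g h)).congr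
      fun i => (inner_add_left _ _ _).symm
  smul_left f g c := by
    refine tendsto_nhds_unique (tendsto_limUnder_inner (c • f) g) ?_
    exact ((tendsto_limUnder_inner f g).const_mul _).congr fun i => (inner_smul_left _ _ _).symm

instance : SeminormedAddCommGroup (PreUltraproduct 𝒰 H) :=
  InnerProductSpace.Core.toSeminormedAddCommGroup (𝕜 := ℂ)

instance : InnerProductSpace ℂ (PreUltraproduct 𝒰 H) := InnerProductSpace.ofCore core

theorem tendsto_inner (f g : PreUltraproduct 𝒰 H) :
    Tendsto (fun i => (inner ℂ (f.1 i) (g.1 i) : ℂ)) 𝒰 (𝓝 (inner ℂ f g)) :=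
  tendsto_limUnder_inner f g

/-- A linear isometry acts on bounded families coordinatewise. -/
def map : (H →ₗᵢ[ℂ] H) →* (PreUltraproduct 𝒰 H →ₗᵢ[ℂ] PreUltraproduct 𝒰 H) where
  toFun A := LinearMap.isometryOfInner
    { toFun := fun f => ⟨fun i => A (f.1 i), by
        obtain ⟨C, hC⟩ := f.2
        exact ⟨C, fun i => (A.norm_map _).trans_le (hC i)⟩⟩
      map_add' := fun f g => Subtype.ext (funext fun i => A.map_add _ _)
      map_smul' := fun c f => Subtype.ext (funext fun i => A.map_smul _ _) } fun f g =>
    tendsto_nhds_unique (tendsto_inner _ _) ((tendsto_inner f g).congr fun i =>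
      (A.inner_map_map _ _).symm)
  map_one' := rfl
  map_mul' _ _ := rfl

theorem tendsto_inner_map (A : H →ₗᵢ[ℂ] H) (f g : PreUltraproduct 𝒰 H) :
    Tendsto (fun i => (inner ℂ (f.1 i) (A (g.1 i)) : ℂ)) 𝒰 (𝓝 (inner ℂ f (map A g))) :=
  tendsto_inner f (map A g)

/-- The constant families. -/
def diag : H →ₗᵢ[ℂ] PreUltraproduct 𝒰 H := LinearMap.isometryOfInner
  { toFun := fun x => ⟨fun _ => x, ‖x‖, fun _ => le_rfl⟩
    map_add' := fun _ _ => rfl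
    map_smul' := fun _ _ => rfl } fun _ _ =>
  tendsto_nhds_unique (tendsto_inner _ _) tendsto_const_nhds

end PreUltraproduct

end Ultraproduct

open UniformSpace in
/-- The extension of linear isometries to the completion, as a homomorphism. -/
def LinearIsometry.mapCompletion {V : Type*} [SeminormedAddCommGroup V] [InnerProductSpace ℂ V] :
    (V →ₗᵢ[ℂ] V) →* (Completion V →ₗᵢ[ℂ] Completion V) where
  toFun A :=
    { toFun := Completion.map A
      map_add' := fun x y => by
        have hcont : Continuous (Completion.map A) := Completion.continuous_map
        refine Completion.induction_on₂ x y (isClosed_eq (by fun_prop) (by fun_prop)) fun a b => ?_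
        rw [← Completion.coe_add]
        simp only [Completion.map_coe A.isometry.uniformContinuous]
        rw [A.map_add, Completion.coe_add]
      map_smul' := fun c x => by
        have hcont : Continuous (Completion.map A) := Completion.continuous_map
        refine Completion.induction_on x (isClosed_eq (hcont.comp (continuous_const_smul c))
          ((continuous_const_smul c).comp hcont)) fun a => ?_
        rw [← Completion.coe_smul]
        simp only [Completion.map_coe A.isometry.uniformContinuous]
        rw [A.map_smul, Completion.coe_smul, RingHom.id_apply]
      norm_map' := fun x => by
        refine Completion.induction_on x (isClosed_eq ?_ continuous_norm) fun a => ?_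
        · exact continuous_norm.comp Completion.continuous_map
        · change ‖Completion.map A a‖ = _
          rw [Completion.map_coe A.isometry.uniformContinuous, Completion.norm_coe,
            Completion.norm_coe, A.norm_map] }
  map_one' := LinearIsometry.ext fun x => congrFun Completion.map_id x
  map_mul' A B := LinearIsometry.ext fun x => (congrFun (Completion.map_comp
    A.isometry.uniformContinuous B.isometry.uniformContinuous) x).symm

theorem LinearIsometry.mapCompletion_coe {V : Type*} [SeminormedAddCommGroup V]
    [InnerProductSpace ℂ V] (A : V →ₗᵢ[ℂ] V) (v : V) :
    LinearIsometry.mapCompletion A (v : UniformSpace.Completion V) = (A v : V) :=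
  UniformSpace.Completion.map_coe A.isometry.uniformContinuous v

/-! ### Weak containment of unitary representations -/

section Representations

variable {Γ H : Type*} [Group Γ] [NormedAddCommGroup H] [InnerProductSpace ℂ H] [CompleteSpace H]

/-- A unitary representation as a homomorphism to the monoid of linear isometries. Since the source
is a group, the isometries in the image of such a homomorphism are automatically onto. -/
def UnitaryRep.toIsometric (α : UnitaryRep Γ H) : Γ →* (H →ₗᵢ[ℂ] H) where
  toFun γ := (Unitary.linearIsometryEquiv (α γ)).toLinearIsometry
  map_one' := by rw [map_one, map_one]; rfl
  map_mul' γ γ' := by rw [map_mul, map_mul]; rfl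

/-- The unitary representation given by a homomorphism to the monoid of linear isometries. -/
def UnitaryRep.ofIsometric (ρ : Γ →* (H →ₗᵢ[ℂ] H)) : UnitaryRep Γ H where
  toFun γ := Unitary.linearIsometryEquiv.symm
    { (ρ γ) with
      invFun := ρ γ⁻¹
      left_inv := fun x => by
        change (ρ γ⁻¹ * ρ γ) x = x
        rw [← map_mul, inv_mul_cancel, map_one]; rfl
      right_inv := fun x => by
        change (ρ γ * ρ γ⁻¹) x = x
        rw [← map_mul, mul_inv_cancel, map_one]; rfl }
  map_one' := by ext x; change ρ 1 x = x; rw [map_one]; rfl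
  map_mul' γ γ' := by ext x; change ρ (γ * γ') x = ρ γ (ρ γ' x); rw [map_mul]; rfl

variable {E : Type*} [NormedAddCommGroup E] [InnerProductSpace ℂ E] [CompleteSpace E]

/-- Vectors with the same matrix coefficients as a Hilbert basis under `δ` span a copy of `δ`. The
compression of `A γ` to the closed span is `δ γ`; since `A γ` and `δ γ` are both isometric, the
span is then invariant. -/
theorem exists_equivariant_isometry_of_inner_eq {s : Type*} (b : HilbertBasis s ℂ H)
    (δ : Γ →* (H →ₗᵢ[ℂ] H)) (A : Γ →* (E →ₗᵢ[ℂ] E)) (e : s → E)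
    (he : ∀ γ j k, (inner ℂ (e k) (A γ (e j)) : ℂ) = inner ℂ (b k) (δ γ (b j))) :
    ∃ T : H →ₗᵢ[ℂ] E, ∀ γ v, T (δ γ v) = A γ (T v) := by
  classical
  have heo : Orthonormal ℂ e := by
    rw [orthonormal_iff_ite]
    intro k j
    have := he 1 j k
    simp only [map_one, LinearIsometry.coe_one, id_eq] at this
    rw [this, orthonormal_iff_ite.1 b.orthonormal]
  let T : H →ₗᵢ[ℂ] E := heo.orthogonalFamily.linearIsometry.comp b.repr.toLinearIsometry
  have hT : ∀ j, T (b j) = e j := fun j => by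
    change heo.orthogonalFamily.linearIsometry (b.repr (b j)) = e j
    rw [b.repr_self, heo.orthogonalFamily.linearIsometry_apply_single]
    simp
  refine ⟨T, fun γ => ?_⟩
  -- the compression of `A γ` to the range of `T` is `δ γ`, by comparing matrix coefficients
  have hcomp : ∀ x y, (inner ℂ (T x) (A γ (T y)) : ℂ) = inner ℂ x (δ γ y) := by
    let L := T.toContinuousLinearMap.adjoint ∘L (A γ).toContinuousLinearMap ∘L
      T.toContinuousLinearMap
    have hL : L = (δ γ).toContinuousLinearMap := by
      refine ContinuousLinearMap.ext_on (s := range b) ?_ ?_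
      · exact Submodule.dense_iff_topologicalClosure_eq_top.2 b.dense_span
      · rintro _ ⟨j, rfl⟩
        refine b.repr.injective (lp.ext (funext fun k => ?_))
        rw [b.repr_apply_apply, b.repr_apply_apply]
        change (inner ℂ (b k) (T.toContinuousLinearMap.adjoint (A γ (T (b j)))) : ℂ) = _
        rw [ContinuousLinearMap.adjoint_inner_right]
        change (inner ℂ (T (b k)) (A γ (T (b j))) : ℂ) = _
        rw [hT, hT, he]
        rfl
    intro x y
    rw [← (δ γ).coe_toContinuousLinearMap, ← hL]
    exact (ContinuousLinearMap.adjoint_inner_right T.toContinuousLinearMap x (A γ (T y))).symm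
  intro v
  -- `‖T (δ γ v) - A γ (T v)‖² = 2 ‖v‖² - 2 re ⟪δ γ v, δ γ v⟫ = 0`
  rw [← sub_eq_zero, ← norm_eq_zero, ← sq_eq_zero_iff, @norm_sub_sq ℂ, hcomp,
    inner_self_eq_norm_sq_to_K]
  simp only [LinearIsometry.norm_map]
  norm_cast
  ring

/-- Let `A` contain both `α` and `δ`, and let the matrix coefficients of finite orthonormal systems
under `A` be approximated by those under `α`. Then the restriction of `A` to the closed span of the
two copies can be realized on `H`, and it is as wanted. -/
theorem exists_weaklyEquivalent_hasSubrep_of_extension {D T : H →ₗᵢ[ℂ] E}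
    [SeparableSpace H] (α δ : UnitaryRep Γ H)
    (A : Γ →* (E →ₗᵢ[ℂ] E))
    (hD : ∀ γ v, D ((α γ : H →L[ℂ] H) v) = A γ (D v))
    (hT : ∀ γ v, T ((δ γ : H →L[ℂ] H) v) = A γ (T v))
    (happ : ∀ (n : ℕ) (v : Fin n → E), Orthonormal ℂ v → ∀ (F : Finset Γ) (ε : ℝ), 0 < ε →
      ∃ w : Fin n → H, Orthonormal ℂ w ∧ ∀ i j, ∀ γ ∈ F,
        ‖inner ℂ (v j) (A γ (v i)) - inner ℂ (w j) ((α γ : H →L[ℂ] H) (w i))‖ < ε) :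
    ∃ β : UnitaryRep Γ H, UnitaryRep.WeaklyEquivalent β α ∧ UnitaryRep.HasSubrep β δ := by
  let L : H × H →L[ℂ] E := D.toContinuousLinearMap.coprod T.toContinuousLinearMap
  let K : Submodule ℂ E := (LinearMap.range L.toLinearMap).topologicalClosure
  have hKc : IsClosed (K : Set E) := Submodule.isClosed_topologicalClosure _
  have : CompleteSpace K := hKc.completeSpace_coe
  have : SeparableSpace K := by
    have : IsSeparable (K : Set E) := (isSeparable_range L.continuous).closure
    exact this.separableSpace
  have hLK : ∀ x, L x ∈ K := fun x => subset_closure ⟨x, rfl⟩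
  have hDK : ∀ x, D x ∈ K := fun x => by simpa [L] using hLK (x, 0)
  have hTK : ∀ x, T x ∈ K := fun x => by simpa [L] using hLK (0, x)
  have hAK : ∀ γ, ∀ x ∈ K, A γ x ∈ K := by
    intro γ x hx
    refine map_mem_closure (A γ).continuous hx ?_
    rintro _ ⟨⟨y, z⟩, rfl⟩
    refine ⟨((α γ : H →L[ℂ] H) y, (δ γ : H →L[ℂ] H) z), ?_⟩
    change D ((α γ : H →L[ℂ] H) y) + T ((δ γ : H →L[ℂ] H) z) = A γ (D y + T z)
    rw [hD, hT, map_add]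
  let AK : Γ →* (K →ₗᵢ[ℂ] K) :=
    { toFun := fun γ => ⟨(A γ).toLinearMap.restrict (hAK γ), fun x => (A γ).norm_map x⟩
      map_one' := by ext x; change A 1 (x : E) = x; rw [map_one]; rfl
      map_mul' := fun γ γ' => by
        ext x
        change A (γ * γ') (x : E) = A γ (A γ' x)
        rw [map_mul]; rfl }
  have hAKv : ∀ γ x, ((AK γ x : K) : E) = A γ x := fun γ x => rfl
  let D' : H →ₗᵢ[ℂ] K := ⟨D.toLinearMap.codRestrict K hDK, fun x => D.norm_map x⟩
  let T' : H →ₗᵢ[ℂ] K := ⟨T.toLinearMap.codRestrict K hTK, fun x => T.norm_map x⟩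
  have hval : ∀ {n : ℕ} {v : Fin n → K}, Orthonormal ℂ v → Orthonormal ℂ fun i => (v i : E) :=
    fun hv => hv.comp_linearIsometry K.subtypeₗᵢ
  obtain ⟨J⟩ := nonempty_linearIsometryEquiv_of_orthonormal D' fun n v hv => by
    obtain ⟨w, hw, -⟩ := happ n _ (hval hv) ∅ 1 one_pos
    exact ⟨w, hw⟩
  let β : UnitaryRep Γ H := UnitaryRep.ofIsometric
    { toFun := fun γ => J.toLinearIsometry.comp ((AK γ).comp J.symm.toLinearIsometry)
      map_one' := by ext x; simp
      map_mul' := fun γ γ' => by ext x; simp }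
  have hβ : ∀ γ x, (β γ : H →L[ℂ] H) x = J (AK γ (J.symm x)) := fun γ x => rfl
  refine ⟨β, ⟨?_, ?_⟩, J.toLinearIsometry.comp T', fun γ v => ?_⟩
  · intro n v hv F ε hε
    refine ⟨fun i => J (D' (v i)), (hv.comp_linearIsometry D').comp_linearIsometryEquiv J,
      fun i j γ _ => ?_⟩
    have : AK γ (D' (v i)) = D' ((α γ : H →L[ℂ] H) (v i)) := Subtype.ext (hD γ (v i)).symm
    rw [hβ, J.symm_apply_apply, J.inner_map_map, this, D'.inner_map_map, sub_self, norm_zero]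
    exact hε
  · intro n v hv F ε hε
    obtain ⟨w, hw, hwF⟩ := happ n _ (hval (hv.comp_linearIsometryEquiv J.symm)) F ε hε
    refine ⟨w, hw, fun i j γ hγ => ?_⟩
    have : (inner ℂ (v j) ((β γ : H →L[ℂ] H) (v i)) : ℂ) =
        inner ℂ ((J.symm (v j) : K) : E) (A γ (J.symm (v i) : K)) := by
      rw [hβ, ← hAKv, ← Submodule.coe_inner, ← J.inner_map_map, J.apply_symm_apply]
    rw [this]
    exact hwF i j γ hγ
  · have : AK γ (T' v) = T' ((δ γ : H →L[ℂ] H) v) := Subtype.ext (hT γ v).symm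
    change J (T' _) = (β γ : H →L[ℂ] H) (J (T' v))
    rw [hβ, J.symm_apply_apply, this]

/-- The ultrapower of `α` is weakly contained in `α`: approximate the given vectors by bounded
families, take a coordinate at which the finitely many inner products are close to their limits,
and orthonormalize there. -/
theorem exists_orthonormal_near_of_ultraproduct {ι : Type*} (𝒰 : Ultrafilter ι)
    (α : UnitaryRep Γ H) {n : ℕ}
    (v : Fin n → UniformSpace.Completion (PreUltraproduct 𝒰 H)) (hv : Orthonormal ℂ v)
    (F : Finset Γ) {ε : ℝ} (hε : 0 < ε) :
    ∃ w : Fin n → H, Orthonormal ℂ w ∧ ∀ i j, ∀ γ ∈ F,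
      ‖inner ℂ (v j) (LinearIsometry.mapCompletion (PreUltraproduct.map (α.toIsometric γ)) (v i)) -
        inner ℂ (w j) ((α γ : H →L[ℂ] H) (w i))‖ < ε := by
  classical
  have hu : ∀ (m : ℕ) i, ∃ u : PreUltraproduct 𝒰 H, dist (v i) u < 1 / ((m : ℝ) + 1) := by
    intro m i
    obtain ⟨_, ⟨u, rfl⟩, h⟩ := Metric.mem_closure_iff.1
      (UniformSpace.Completion.denseRange_coe (v i)) (1 / ((m : ℝ) + 1)) (by positivity)
    exact ⟨u, h⟩
  choose u hu using hu
  have hutend : ∀ i, Tendsto (fun m => (u m i : UniformSpace.Completion (PreUltraproduct 𝒰 H)))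
      atTop (𝓝 (v i)) := fun i => by
    rw [tendsto_iff_dist_tendsto_zero]
    refine squeeze_zero (fun _ => dist_nonneg) (fun m => ?_)
      (tendsto_one_div_add_atTop_nhds_zero_nat (𝕜 := ℝ))
    rw [dist_comm]
    exact (hu m i).le
  set B : Γ → _ := fun γ =>
    LinearIsometry.mapCompletion (PreUltraproduct.map (𝒰 := 𝒰) (α.toIsometric γ)) with hB
  have hk : ∀ m : ℕ, ∃ k : ι, ∀ i j, ∀ γ ∈ insert 1 F,
      dist (inner ℂ ((u m j).1 k) ((α γ : H →L[ℂ] H) ((u m i).1 k)) : ℂ)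
        (inner ℂ (u m j) (PreUltraproduct.map (α.toIsometric γ) (u m i))) <
        1 / ((m : ℝ) + 1) := by
    intro m
    refine Eventually.exists (f := (𝒰 : Filter ι)) ?_
    rw [eventually_all]; intro i
    rw [eventually_all]; intro j
    rw [Finset.eventually_all]; intro γ _
    exact Metric.tendsto_nhds.1
      (PreUltraproduct.tendsto_inner_map (α.toIsometric γ) (u m j) (u m i)) _ (by positivity)
  choose k hk using hk
  have hcoef : ∀ i j, ∀ γ ∈ insert 1 F, Tendsto (fun m =>
      (inner ℂ ((u m j).1 (k m)) ((α γ : H →L[ℂ] H) ((u m i).1 (k m))) : ℂ)) atTop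
      (𝓝 (inner ℂ (v j) (B γ (v i)))) := by
    intro i j γ hγ
    have h1 : Tendsto (fun m => (inner ℂ (u m j) (PreUltraproduct.map (α.toIsometric γ) (u m i)) :
        ℂ)) atTop (𝓝 (inner ℂ (v j) (B γ (v i)))) := by
      refine ((hutend j).inner (((B γ).continuous.tendsto _).comp (hutend i))).congr fun m => ?_
      rw [Function.comp_apply, hB, LinearIsometry.mapCompletion_coe,
        UniformSpace.Completion.inner_coe]
    refine h1.congr_dist (squeeze_zero (fun _ => dist_nonneg) (fun m => ?_)
      (tendsto_one_div_add_atTop_nhds_zero_nat (𝕜 := ℝ)))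
    rw [dist_comm]
    exact (hk m i j γ hγ).le
  have hgram : ∀ i j, Tendsto (fun m => (inner ℂ ((u m i).1 (k m)) ((u m j).1 (k m)) : ℂ)) atTop
      (𝓝 (if i = j then 1 else 0)) := by
    intro i j
    have := hcoef j i 1 (Finset.mem_insert_self _ _)
    simp only [hB, map_one] at this
    change Tendsto _ _ (𝓝 (inner ℂ (v i) (v j))) at this
    rw [orthonormal_iff_ite.1 hv] at this
    exact this
  -- the element `1` was added to `F` so that the Gram matrices are controlled as well
  obtain ⟨w, hwo, hw⟩ := exists_orthonormal_of_tendsto hgram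
  have hbd : ∀ i, Tendsto (fun m => ‖(u m i).1 (k m)‖) atTop (𝓝 1) := fun i =>
    tendsto_norm_one_of_inner (by simpa using hgram i i)
  have hwcoef : ∀ i j, ∀ γ ∈ F, Tendsto (fun m =>
      (inner ℂ (w m j) ((α γ : H →L[ℂ] H) (w m i)) : ℂ)) atTop
      (𝓝 (inner ℂ (v j) (B γ (v i)))) := by
    intro i j γ hγ
    have hn : ∀ i, Tendsto (fun m => ‖w m i - (u m i).1 (k m)‖) atTop (𝓝 0) := fun i =>
      tendsto_zero_iff_norm_tendsto_zero.1 (hw i)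
    have hαn : ∀ x, ‖(α γ : H →L[ℂ] H) x‖ = ‖x‖ := (α.toIsometric γ).norm_map
    have t1 : Tendsto (fun m => (inner ℂ (w m j - (u m j).1 (k m))
        ((α γ : H →L[ℂ] H) (w m i - (u m i).1 (k m))) : ℂ)) atTop (𝓝 0) := by
      refine squeeze_zero_norm (fun m => norm_inner_le_norm _ _) ?_
      simp only [hαn]
      simpa using (hn j).mul (hn i)
    have t2 : Tendsto (fun m => (inner ℂ (w m j - (u m j).1 (k m))
        ((α γ : H →L[ℂ] H) ((u m i).1 (k m))) : ℂ)) atTop (𝓝 0) := by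
      refine squeeze_zero_norm (fun m => norm_inner_le_norm _ _) ?_
      simp only [hαn]
      simpa using (hn j).mul (hbd i)
    have t3 : Tendsto (fun m => (inner ℂ ((u m j).1 (k m))
        ((α γ : H →L[ℂ] H) (w m i - (u m i).1 (k m))) : ℂ)) atTop (𝓝 0) := by
      refine squeeze_zero_norm (fun m => norm_inner_le_norm _ _) ?_
      simp only [hαn]
      simpa using (hbd j).mul (hn i)
    have t4 := ((t1.add t2).add t3).add (hcoef i j γ (Finset.mem_insert_of_mem hγ))
    simp only [zero_add] at t4
    refine t4.congr fun m => ?_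
    simp only [map_sub, inner_sub_left, inner_sub_right]
    ring
  have hev : ∀ᶠ m in atTop, ∀ i j, ∀ γ ∈ F,
      dist (inner ℂ (w m j) ((α γ : H →L[ℂ] H) (w m i)) : ℂ) (inner ℂ (v j) (B γ (v i))) < ε := by
    rw [eventually_all]; intro i
    rw [eventually_all]; intro j
    rw [Finset.eventually_all]; intro γ hγ
    exact Metric.tendsto_nhds.1 (hwcoef i j γ hγ) ε hε
  obtain ⟨m, hm1, hm2⟩ := (hwo.and hev).exists
  refine ⟨w m, hm1, fun i j γ hγ => ?_⟩
  rw [← dist_eq_norm, dist_comm]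
  exact hm2 i j γ hγ

/-- If `α` weakly contains `δ`, then the ultrapower of `α` over the finite parts of the data
contains vectors with the matrix coefficients of a Hilbert basis under `δ`. -/
theorem UnitaryRep.WeaklyContains.exists_ultraproduct {α δ : UnitaryRep Γ H}
    (hαδ : UnitaryRep.WeaklyContains α δ) {s : Type*} (b : HilbertBasis s ℂ H) :
    ∃ (𝒰 : Ultrafilter (Finset Γ × Finset s × ℕ)) (e : s → PreUltraproduct 𝒰 H), ∀ γ j k,
      (inner ℂ (e k) (PreUltraproduct.map (α.toIsometric γ) (e j)) : ℂ) =
        inner ℂ (b k) (δ.toIsometric γ (b j)) := by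
  classical
  have key : ∀ i : Finset Γ × Finset s × ℕ, ∃ w : s → H, (∀ j, ‖w j‖ ≤ 1) ∧
      ∀ j ∈ i.2.1, ∀ k ∈ i.2.1, ∀ γ ∈ i.1,
        ‖(inner ℂ (b k) ((δ γ : H →L[ℂ] H) (b j)) : ℂ) -
          inner ℂ (w k) ((α γ : H →L[ℂ] H) (w j))‖ < 1 / ((i.2.2 : ℝ) + 1) := by
    rintro ⟨F, t, N⟩
    obtain ⟨w, hw, hwF⟩ := hαδ t.card (fun j => b (t.equivFin.symm j))
      (b.orthonormal.comp _ (Subtype.val_injective.comp t.equivFin.symm.injective)) F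
      (1 / ((N : ℝ) + 1)) (by positivity)
    refine ⟨fun j => if h : j ∈ t then w (t.equivFin ⟨j, h⟩) else 0, fun j => ?_, ?_⟩
    · dsimp only
      split_ifs
      · exact (hw.1 _).le
      · simp
    · intro j hj k hk γ hγ
      have := hwF (t.equivFin ⟨j, hj⟩) (t.equivFin ⟨k, hk⟩) γ hγ
      dsimp only at hj hk ⊢
      rw [dif_pos hj, dif_pos hk]
      simpa only [Equiv.symm_apply_apply] using this
  choose w hw1 hw using key
  let 𝒰 : Ultrafilter (Finset Γ × Finset s × ℕ) := Ultrafilter.of atTop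
  have h𝒰 : (𝒰 : Filter (Finset Γ × Finset s × ℕ)) ≤ atTop := Ultrafilter.of_le atTop
  refine ⟨𝒰, fun j => ⟨fun i => w i j, 1, fun i => hw1 i j⟩, fun γ j k => ?_⟩
  refine tendsto_nhds_unique (PreUltraproduct.tendsto_inner _ _) ?_
  refine Tendsto.mono_left ?_ h𝒰
  rw [Metric.tendsto_nhds]
  intro ε hε
  obtain ⟨N, hN⟩ := exists_nat_one_div_lt hε
  filter_upwards [eventually_ge_atTop (({γ}, {j, k}, N) : Finset Γ × Finset s × ℕ)] with i hi
  have h1 := hw i j (hi.2.1 (by simp)) k (hi.2.1 (by simp)) γ (hi.1 (by simp))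
  rw [dist_comm, dist_eq_norm]
  refine (h1.trans_le ?_).trans hN
  exact one_div_le_one_div_of_le (by positivity) (by simpa using hi.2.2)

theorem UnitaryRep.WeaklyContains.exists_weaklyEquivalent_hasSubrep [SeparableSpace H]
    {α δ : UnitaryRep Γ H} (hαδ : UnitaryRep.WeaklyContains α δ) :
    ∃ β : UnitaryRep Γ H, UnitaryRep.WeaklyEquivalent β α ∧ UnitaryRep.HasSubrep β δ := by
  obtain ⟨s, b, -⟩ := exists_hilbertBasis ℂ H
  obtain ⟨𝒰, e, he⟩ := hαδ.exists_ultraproduct b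
  let A := (LinearIsometry.mapCompletion (V := PreUltraproduct 𝒰 H)).comp
    ((PreUltraproduct.map (𝒰 := 𝒰)).comp α.toIsometric)
  obtain ⟨T, hT⟩ := exists_equivariant_isometry_of_inner_eq b δ.toIsometric A
    (fun j => (e j : UniformSpace.Completion (PreUltraproduct 𝒰 H))) fun γ j k => by
      rw [← he]
      change (inner ℂ _ (LinearIsometry.mapCompletion _ _) : ℂ) = _
      rw [LinearIsometry.mapCompletion_coe, UniformSpace.Completion.inner_coe]
      rfl
  refine exists_weaklyEquivalent_hasSubrep_of_extension
    (D := (UniformSpace.Completion.toComplₗᵢ (𝕜 := ℂ)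
      (E := PreUltraproduct 𝒰 H)).comp PreUltraproduct.diag) (T := T)
    α δ A (fun γ v => ?_) hT fun n v hv F ε hε =>
      exists_orthonormal_near_of_ultraproduct 𝒰 α v hv F hε
  exact (LinearIsometry.mapCompletion_coe (PreUltraproduct.map (α.toIsometric γ))
    (PreUltraproduct.diag v)).symm

end Representations

end

theorem mainTheorem5
    {S : Type*} [Finite S]
    {X : Type*} [MeasurableSpace X] [StandardBorelSpace X]
    (μ : Measure X) [IsProbabilityMeasure μ] [NullSingletonClass μ]
    {Γ : Type*} [Group Γ] [Countable Γ]
    {H : Type*} [NormedAddCommGroup H] [InnerProductSpace ℂ H] [CompleteSpace H]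
    [SeparableSpace H] :
    (∀ f h : PMPAction S μ, f.WeaklyContains h →
      ∃ g : PMPAction S μ, g.WeaklyEquivalent f ∧ g.HasFactor h) ∧
    (∀ α δ : UnitaryRep Γ H, UnitaryRep.WeaklyContains α δ →
      ∃ β : UnitaryRep Γ H, UnitaryRep.WeaklyEquivalent β α ∧ UnitaryRep.HasSubrep β δ) := by
  exact ⟨fun _ _ hfh => hfh.exists_weaklyEquivalent_hasFactor,
    fun _ _ hαδ => hαδ.exists_weaklyEquivalent_hasSubrep⟩
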